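/- Let $(M^n,g)$ be a closed (compact, without boundary) smooth Riemannian manifold with Riemannian measure $dV$, and let $\theta$ be a smooth closed real $1$-form on $M$. Put $d_\theta\alpha=d\alpha+\theta\wedge\alpha$ on the space $\Omega^*(M)$ of smooth real differential forms, let $d^*$ and $d_\theta^*$ be the formal $L^2$ adjoints of $d$ and $d_\theta$ with respect to $g$ (zero on $0$-forms), and let $\Delta_\theta=d_\theta d_\theta^*+d_\theta^*d_\theta$. Let $X$ be the vector field dual to $\theta$, that is, $g(X,Y)=\theta(Y)$ for all $Y$. Let $0\le p\le n$ and let $\alpha\in\Omega^p(M)$ be $\Delta_\theta$-harmonic, that is, $\Delta_\theta\alpha=0$. Then $$d\alpha+\theta\wedge\alpha=0,\qquad d^*\alpha+i_X\alpha=0,$$ and $$\int_M |X|^2|\alpha|^2\,dV=\frac12\int_M \alpha\wedge[L_X,*]\alpha .$$ Here $|\alpha|^2=\langle\alpha,\alpha\rangle$ is the pointwise inner product on $p$-forms induced by $g$, $L_X$ is the Lie derivative along $X$, $*$ is the Hodge star operator of $g$, normalised by $\eta\wedge *\omega=\langle\eta,\omega\rangle\,dV$, and $[L_X,*]\alpha=L_X{*}\alpha-{*}L_X\alpha$.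 The manifold $M$ need not be orientable or connected: $*$ is taken with respect to local orientations, and $\alpha\wedge[L_X,*]\alpha=f\,dV$ with a function $f$ that does not depend on them, so that the integral on the right is $\int_M f\,dV$. -/

import Mathlib

open scoped Manifold ContDiff Nat
open MeasureTheory

noncomputable section

namespace MorseNovikov

/-! ### Exterior algebra of a vector space -/

section Algebra

variable {V : Type*} [AddCommGroup V] [Module ℝ V] [TopologicalSpace V]

/-- The multilinear map `v ↦ a (v₁, …, v_p) * b (v_{p+1}, …, v_r)`, where `r = p + q`. -/
def tensor {p q r : ℕ} (h : p + q = r) (a : V [⋀^Fin p]→L[ℝ] ℝ) (b : V [⋀^Fin q]→L[ℝ] ℝ) :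
    ContinuousMultilinearMap ℝ (fun _ : Fin r => V) ℝ where
  toFun v := a (fun i => v (Fin.cast h (Fin.castAdd q i))) *
    b (fun j => v (Fin.cast h (Fin.natAdd p j)))
  map_update_add' := by
    subst h
    intro _ v k x y
    have key : ∀ z : V, (a (fun i => Function.update v k z (Fin.castAdd q i)) *
        b (fun j => Function.update v k z (Fin.natAdd p j))) =
        Fin.addCases (motive := fun _ => ℝ)
          (fun i => a (Function.update (fun i => v (Fin.castAdd q i)) i z) *
            b (fun j => v (Fin.natAdd p j)))
          (fun j => a (fun i => v (Fin.castAdd q i)) *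
            b (Function.update (fun j => v (Fin.natAdd p j)) j z)) k := by
      intro z
      induction k using Fin.addCases with
      | left i =>
        simp only [Fin.addCases_left]
        congr 2
        · funext i₁; simp [Function.update_apply]
        · funext j₁; simp [Function.update_apply, Fin.ext_iff]; omega
      | right j =>
        simp only [Fin.addCases_right]
        congr 2
        · funext i₁; simp [Function.update_apply, Fin.ext_iff]; omega
        · funext j₁; simp [Function.update_apply]
    simp only [Fin.cast_refl, id_eq]
    have e : ‹DecidableEq (Fin (p + q))› = instDecidableEqFin (p + q) := Subsingleton.elim _ _
    subst e
    rw [key, key, key]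
    induction k using Fin.addCases with
    | left i => simp [add_mul]
    | right j => simp [mul_add]
  map_update_smul' := by
    subst h
    intro _ v k c x
    have key : ∀ z : V, (a (fun i => Function.update v k z (Fin.castAdd q i)) *
        b (fun j => Function.update v k z (Fin.natAdd p j))) =
        Fin.addCases (motive := fun _ => ℝ)
          (fun i => a (Function.update (fun i => v (Fin.castAdd q i)) i z) *
            b (fun j => v (Fin.natAdd p j)))
          (fun j => a (fun i => v (Fin.castAdd q i)) *
            b (Function.update (fun j => v (Fin.natAdd p j)) j z)) k := by
      intro z
      induction k using Fin.addCases with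
      | left i =>
        simp only [Fin.addCases_left]
        congr 2
        · funext i₁; simp [Function.update_apply]
        · funext j₁; simp [Function.update_apply, Fin.ext_iff]; omega
      | right j =>
        simp only [Fin.addCases_right]
        congr 2
        · funext i₁; simp [Function.update_apply, Fin.ext_iff]; omega
        · funext j₁; simp [Function.update_apply]
    simp only [Fin.cast_refl, id_eq]
    have e : ‹DecidableEq (Fin (p + q))› = instDecidableEqFin (p + q) := Subsingleton.elim _ _
    subst e
    rw [key, key]
    induction k using Fin.addCases with
    | left i => simp [mul_assoc]
    | right j => simp [mul_left_comm]
  cont := by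
    refine (a.cont.comp ?_).mul (b.cont.comp ?_) <;> fun_prop

/-- The wedge product `a ∧ b = (p! q!)⁻¹ ∑_σ sign(σ) (a ⊗ b) ∘ σ`, in degree `r = p + q`. -/
def wedge {p q r : ℕ} (h : p + q = r) (a : V [⋀^Fin p]→L[ℝ] ℝ) (b : V [⋀^Fin q]→L[ℝ] ℝ) :
    V [⋀^Fin r]→L[ℝ] ℝ :=
  ((p ! : ℝ) * (q ! : ℝ))⁻¹ • ContinuousMultilinearMap.alternatization (tensor h a b)

/-- The interior product `i_x w = w (x, ·, …, ·)`; it is zero on forms of degree zero. -/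
def interiorProd (x : V) : {p : ℕ} → V [⋀^Fin p]→L[ℝ] ℝ → V [⋀^Fin (p - 1)]→L[ℝ] ℝ
  | 0, _ => 0
  | _ + 1, w =>
    { w.toAlternatingMap.curryLeft x with
      cont := w.cont.comp (continuous_const.matrixVecCons continuous_id) }

end Algebra

/-! ### Riemannian linear algebra and the Lie derivative in coordinates -/

/-- The coordinate space `ℝⁿ`. -/
abbrev Coord (n : ℕ) : Type := EuclideanSpace ℝ (Fin n)

/-- The coordinate vectors `∂₁, …, ∂ₙ`. -/
def std {n : ℕ} (i : Fin n) : Coord n := EuclideanSpace.single i 1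

/-- The form `dx¹ ∧ … ∧ dxⁿ`. -/
def coordVol (n : ℕ) : (Coord n) [⋀^Fin n]→L[ℝ] ℝ :=
  { (Matrix.detRowAlternating (n := Fin n) (R := ℝ)).compLinearMap
      (EuclideanSpace.equiv (Fin n) ℝ).toLinearMap with
    cont := by
      change Continuous fun v : Fin n → Coord n => Matrix.det (Matrix.of fun i j => v i j)
      fun_prop }

/-- The form `μ (u₁, …, u_p, ·, …, ·)` obtained by filling the first `p` slots of `μ`. -/
def insertLeft {n p q : ℕ} (h : p + q = n) (μ : (Coord n) [⋀^Fin n]→L[ℝ] ℝ)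
    (u : Fin p → Coord n) : (Coord n) [⋀^Fin q]→L[ℝ] ℝ where
  toFun v := μ (fun k => Fin.append u v (Fin.cast h.symm k))
  map_update_add' := by
    subst h
    intro _ v j x y
    have key : ∀ z, (fun k => Fin.append u (Function.update v j z) (Fin.cast rfl k)) =
        Function.update (Fin.append u v) (Fin.natAdd p j) z := by
      intro z
      funext k
      induction k using Fin.addCases with
      | left i => simp [Function.update_apply, Fin.ext_iff]; omega
      | right i => simp [Function.update_apply]
    simp only [key, ContinuousAlternatingMap.map_update_add]
  map_update_smul' := by
    subst h
    intro _ v j c x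
    have key : ∀ z, (fun k => Fin.append u (Function.update v j z) (Fin.cast rfl k)) =
        Function.update (Fin.append u v) (Fin.natAdd p j) z := by
      intro z
      funext k
      induction k using Fin.addCases with
      | left i => simp [Function.update_apply, Fin.ext_iff]; omega
      | right i => simp [Function.update_apply]
    simp only [key, ContinuousAlternatingMap.map_update_smul]
  map_eq_zero_of_eq' := by
    subst h
    intro v i j hv hij
    refine μ.map_eq_zero_of_eq _ (i := Fin.natAdd p i) (j := Fin.natAdd p j) ?_ ?_
    · simpa using hv
    · simpa using hij
  cont := by
    subst h
    refine μ.cont.comp (continuous_pi fun k => ?_)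
    induction k using Fin.addCases with
    | left i => simpa using continuous_const
    | right i => simpa using continuous_apply i

/-- For an inner product with Gram matrix `G` in the coordinate basis, the induced inner product
of `p`-forms, `⟨w, η⟩ = (p!)⁻¹ G^{i₁j₁} ⋯ G^{i_pj_p} w_{i₁…i_p} η_{j₁…j_p}`. -/
def coordInner {n p : ℕ} (G : Matrix (Fin n) (Fin n) ℝ) (w η : (Coord n) [⋀^Fin p]→L[ℝ] ℝ) : ℝ :=
  (p ! : ℝ)⁻¹ * ∑ I : Fin p → Fin n, ∑ J : Fin p → Fin n,
    (∏ k, G⁻¹ (I k) (J k)) * w (fun k => std (I k)) * η (fun k => std (J k))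

/-- The volume form `√(det G) dx¹ ∧ … ∧ dxⁿ`. -/
def volForm {n : ℕ} (G : Matrix (Fin n) (Fin n) ℝ) : (Coord n) [⋀^Fin n]→L[ℝ] ℝ :=
  √G.det • coordVol n

/-- The Hodge star of a `p`-form, for the inner product with Gram matrix `G` and the orientation
of `dx¹ ∧ … ∧ dxⁿ`:
`*w = (p!)⁻¹ G^{i₁j₁} ⋯ G^{i_pj_p} w_{i₁…i_p} vol_G (∂_{j₁}, …, ∂_{j_p}, ·, …, ·)`.
It is normalised by `η ∧ *w = ⟨η, w⟩ vol_G`. -/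
def coordStar {n p q : ℕ} (h : p + q = n) (G : Matrix (Fin n) (Fin n) ℝ)
    (w : (Coord n) [⋀^Fin p]→L[ℝ] ℝ) : (Coord n) [⋀^Fin q]→L[ℝ] ℝ :=
  (p ! : ℝ)⁻¹ • ∑ I : Fin p → Fin n, ∑ J : Fin p → Fin n,
    ((∏ k, G⁻¹ (I k) (J k)) * w (fun k => std (I k))) •
      insertLeft h (volForm G) (fun k => std (J k))

/-- The Lie derivative of a form along a vector field in coordinates,
`(L_ξ w)(v₁, …, v_p) = (Dw ξ)(v₁, …, v_p) + ∑ᵢ w (v₁, …, Dξ vᵢ, …, v_p)`. -/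
def coordLie {n p : ℕ} (ξ : Coord n → Coord n) (w : Coord n → (Coord n) [⋀^Fin p]→L[ℝ] ℝ)
    (y : Coord n) : (Coord n) [⋀^Fin p]→L[ℝ] ℝ :=
  fderiv ℝ w y (ξ y) +
    (w y).fderivCompContinuousLinearMap (ContinuousLinearMap.id ℝ (Coord n)) (fderiv ℝ ξ y)

/-- The commutator `[L_ξ, *] w = L_ξ (*w) - *(L_ξ w)` in coordinates, for the Riemannian metric
with Gram matrix `G`. -/
def coordBracket {n p q : ℕ} (h : p + q = n) (G : Coord n → Matrix (Fin n) (Fin n) ℝ)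
    (ξ : Coord n → Coord n) (w : Coord n → (Coord n) [⋀^Fin p]→L[ℝ] ℝ) (y : Coord n) :
    (Coord n) [⋀^Fin q]→L[ℝ] ℝ :=
  coordLie ξ (fun z => coordStar h (G z) (w z)) y - coordStar h (G y) (coordLie ξ w y)

/-- The function `f` with `w = f vol_G`, for a form `w` of top degree. -/
def coordDensity {n : ℕ} (G : Matrix (Fin n) (Fin n) ℝ) (w : (Coord n) [⋀^Fin n]→L[ℝ] ℝ) : ℝ :=
  w std / √G.det

/-! ### Fields on a manifold -/

section Manifold

variable {n : ℕ} {M : Type*} [TopologicalSpace M] [ChartedSpace (Coord n) M]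

variable (n M) in
/-- Fields of `p`-forms on `M` (without any smoothness condition). -/
abbrev FormField (p : ℕ) : Type _ := (x : M) → (TangentSpace (𝓡 n) x) [⋀^Fin p]→L[ℝ] ℝ

variable (n M) in
/-- Vector fields on `M` (without any smoothness condition). -/
abbrev VecField : Type _ := (x : M) → TangentSpace (𝓡 n) x

variable (n M) in
/-- Smooth Riemannian metrics on `M`. -/
abbrev Metric [IsManifold (𝓡 n) ∞ M] : Type _ :=
  Bundle.ContMDiffRiemannianMetric (𝓡 n) ∞ (Coord n) (fun x : M => TangentSpace (𝓡 n) x)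

/-- The derivative at `y` of the inverse of the chart at `c`. -/
def dParam (c : M) (y : Coord n) :
    Coord n →L[ℝ] TangentSpace (𝓡 n) ((extChartAt (𝓡 n) c).symm y) :=
  mfderiv 𝓘(ℝ, Coord n) (𝓡 n) (extChartAt (𝓡 n) c).symm y

/-- The derivative at `x` of the chart at `c`. -/
def dChart (c : M) (x : M) : TangentSpace (𝓡 n) x →L[ℝ] Coord n :=
  mfderiv (𝓡 n) 𝓘(ℝ, Coord n) (extChartAt (𝓡 n) c) x

/-- A field of forms, written in the chart at `c`. -/
def formInChart {p : ℕ} (α : FormField n M p) (c : M) (y : Coord n) :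
    (Coord n) [⋀^Fin p]→L[ℝ] ℝ :=
  (α ((extChartAt (𝓡 n) c).symm y)).compContinuousLinearMap (dParam c y)

/-- A vector field, written in the chart at `c`. -/
def vecInChart (X : VecField n M) (c : M) (y : Coord n) : Coord n :=
  dChart c ((extChartAt (𝓡 n) c).symm y) (X ((extChartAt (𝓡 n) c).symm y))

/-- A field of forms is smooth if its expressions in the charts are. -/
def IsSmoothForm {p : ℕ} (α : FormField n M p) : Prop :=
  ∀ c : M, ContDiffOn ℝ ∞ (formInChart α c) (extChartAt (𝓡 n) c).target

/-- The exterior derivative, computed at `x` in the chart at `x`. -/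
def extDer {p : ℕ} (α : FormField n M p) : FormField n M (p + 1) := fun x =>
  (extDeriv (formInChart α x) (extChartAt (𝓡 n) x x)).compContinuousLinearMap (dChart x x)

/-- The operator `d_θ α = dα + θ ∧ α`. -/
def dTheta (θ : FormField n M 1) {p : ℕ} (α : FormField n M p) : FormField n M (p + 1) :=
  fun x => extDer α x + wedge (Nat.add_comm 1 p) (θ x) (α x)

/-- The field `i_X α`. -/
def interiorField (X : VecField n M) {p : ℕ} (α : FormField n M p) : FormField n M (p - 1) :=
  fun x => interiorProd (X x) (α x)

variable [IsManifold (𝓡 n) ∞ M]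

/-- The matrix `g_{ij}` of the metric in the chart at `c`. -/
def gram (g : Metric n M) (c : M) (y : Coord n) : Matrix (Fin n) (Fin n) ℝ :=
  Matrix.of fun i j =>
    g.inner ((extChartAt (𝓡 n) c).symm y) (dParam c y (std i)) (dParam c y (std j))

/-- The pointwise inner product `⟨α, β⟩` of two fields of `p`-forms. It is computed at `x` in the
chart at `x`. -/
def formInner (g : Metric n M) {p : ℕ} (α β : FormField n M p) (x : M) : ℝ :=
  coordInner (gram g x (extChartAt (𝓡 n) x x))
    (formInChart α x (extChartAt (𝓡 n) x x)) (formInChart β x (extChartAt (𝓡 n) x x))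

/-- The function `f` such that `α ∧ [L_X, *] α = f dV`. It is computed at `x` in the chart at `x`,
where both `*` and `dV` are taken for the orientation of the coordinates. The function does not
depend on that orientation, because its reversal changes the sign of `*` and of `dV`; so `M` need
not be orientable. If `M` is oriented, then `∫ α ∧ [L_X, *] α` is the integral of `f` against
the Riemannian measure. -/
def wedgeBracketDensity (g : Metric n M) (X : VecField n M) {p q : ℕ} (h : p + q = n)
    (α : FormField n M p) (x : M) : ℝ :=
  coordDensity (gram g x (extChartAt (𝓡 n) x x))
    (wedge h (formInChart α x (extChartAt (𝓡 n) x x))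
      (coordBracket h (gram g x) (vecInChart X x) (formInChart α x) (extChartAt (𝓡 n) x x)))

variable [MeasurableSpace M]

/-- The measure `√(det g_{ij}) dx¹ ⋯ dxⁿ` on the domain of the chart at `c`, extended by zero. -/
def chartVolume (g : Metric n M) (c : M) : Measure M :=
  (((volume : Measure (Coord n)).restrict (extChartAt (𝓡 n) c).target).withDensity
    fun y => ENNReal.ofReal √(gram g c y).det).map (extChartAt (𝓡 n) c).symm

/-- The Riemannian measure `dV`, which is `√(det g_{ij}) dx¹ ⋯ dxⁿ` in every chart. As these local
measures agree on overlaps, it is the least measure that dominates all of them. -/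
def riemVolume (g : Metric n M) : Measure M := ⨆ c : M, chartVolume g c

/-- The inner product `∫ ⟨α, β⟩ dV`. -/
def l2Inner (g : Metric n M) {p : ℕ} (α β : FormField n M p) : ℝ :=
  ∫ x, formInner g α β x ∂(riemVolume g)

/-- `β = D* w`, where `D*` is the formal adjoint of the operator `D` from `p`-forms to
`(p+1)`-forms: `β` is smooth, and `∫ ⟨D η, w⟩ dV = ∫ ⟨η, β⟩ dV` for all smooth `p`-forms `η`. -/
def IsAdjointValue (g : Metric n M) {p : ℕ} (D : FormField n M p → FormField n M (p + 1))
    (w : FormField n M (p + 1)) (β : FormField n M p) : Prop :=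
  IsSmoothForm β ∧ ∀ η : FormField n M p, IsSmoothForm η → l2Inner g (D η) w = l2Inner g η β

/-- `β = d* w`, with `d* w = 0` for `w` of degree zero. -/
def IsCodifferential (g : Metric n M) :
    {p : ℕ} → FormField n M p → FormField n M (p - 1) → Prop
  | 0, _, β => β = 0
  | _ + 1, w, β => IsAdjointValue g extDer w β

/-- `α` is `Δ_θ`-harmonic, `d_θ d_θ* α + d_θ* d_θ α = 0`, where `d_θ*` is the formal adjoint of
`d_θ`, with `d_θ* = 0` in degree zero. -/
def IsThetaHarmonic (g : Metric n M) (θ : FormField n M 1) :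
    {p : ℕ} → FormField n M p → Prop
  | 0, α => IsAdjointValue g (dTheta θ) (dTheta θ α) 0
  | _ + 1, α => ∃ β γ, IsAdjointValue g (dTheta θ) α β ∧
      IsAdjointValue g (dTheta θ) (dTheta θ α) γ ∧ ∀ x, dTheta θ β x + γ x = 0

end Manifold

end MorseNovikov

end

open MorseNovikov

noncomputable section

namespace MorseNovikov

/-! ### Forms on the coordinate space -/

section CoordForms

variable {n p q r : ℕ}

/-! Wedging with $\theta$ and contracting with $X$ are pointwise adjoint (`coordInner_wedge_one`,
`formInner_wedge`), so the formal adjoint of $d_\theta$ is $d^*+i_X$. Pairing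
$\Delta_\theta\alpha=0$ with $\alpha$ gives $\|d_\theta^*\alpha\|^2+\|d_\theta\alpha\|^2=0$. Since
the measure is positive on open sets, both forms vanish, which gives the two first-order equations.

For the integral identity, the Leibniz rule for $L_X$ on $\alpha\wedge*\alpha=|\alpha|^2dV$, with
the symmetry of the inner product, yields $\alpha\wedge[L_X,*]\alpha=L_X(|\alpha|^2dV)-2\langle
L_X\alpha,\alpha\rangle dV$ (`wedge_coordBracket`). The first term is the divergence of
$|\alpha|^2X$ and integrates to zero (`integral_divergence_eq_zero`). By Cartan's formula and the
two equations, $\int\langle L_X\alpha,\alpha\rangle=\langle i_Xd\alpha,\alpha\rangle+\langle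
d\,i_X\alpha,\alpha\rangle=-\|\theta\wedge\alpha\|^2-\|i_X\alpha\|^2$, and pointwise
$|\theta\wedge\alpha|^2+|i_X\alpha|^2=|X|^2|\alpha|^2$ because $i_X$ is an antiderivation.

The rest is foundation. The normalisation of the Hodge star is a count of permutations
(`wedge_insertLeft_coordVol`). Quantities defined at $x$ in the chart at $x$ are shown to be
computable in any chart, and the supremum of the chart measures is shown to restrict to each of them
(`riemVolume_apply`). Orientation never enters globally: reversing it changes the coordinate volume
form by a locally constant sign, which cancels in every density. -/

theorem std_apply (i j : Fin n) : (std i : Coord n) j = if j = i then 1 else 0 := by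
  simp [std]

theorem basisFun_toBasis_apply (i : Fin n) :
    (EuclideanSpace.basisFun (Fin n) ℝ).toBasis i = std i := by
  simp [std]

theorem sum_smul_std (v : Coord n) : ∑ i, v i • (std i : Coord n) = v := by
  ext j
  simp [std_apply]

theorem apply_sum_smul_std (w : (Coord n) [⋀^Fin p]→L[ℝ] ℝ) (c : Fin p → Fin n → ℝ) :
    w (fun k => ∑ i, c k i • std i) =
      ∑ I : Fin p → Fin n, (∏ k, c k (I k)) * w (fun k => std (I k)) := by
  rw [← ContinuousAlternatingMap.coe_toContinuousMultilinearMap,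
    ContinuousMultilinearMap.map_sum]
  refine Finset.sum_congr rfl fun I _ => ?_
  rw [ContinuousMultilinearMap.map_smul_univ]
  simp

theorem form_apply_eq_sum (w : (Coord n) [⋀^Fin p]→L[ℝ] ℝ) (v : Fin p → Coord n) :
    w v = ∑ I : Fin p → Fin n, (∏ k, v k (I k)) * w (fun k => std (I k)) := by
  conv_lhs => rw [show v = fun k => ∑ i, v k i • std i from funext fun k => (sum_smul_std _).symm]
  exact apply_sum_smul_std w _

theorem form_ext {w η : (Coord n) [⋀^Fin p]→L[ℝ] ℝ}
    (h : ∀ I : Fin p → Fin n, w (fun k => std (I k)) = η (fun k => std (I k))) : w = η := by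
  ext v
  rw [form_apply_eq_sum, form_apply_eq_sum]
  simp [h]

variable (n p) in
/-- The components of a form on the coordinate space. -/
def components : (Coord n) [⋀^Fin p]→L[ℝ] ℝ →ₗ[ℝ] ((Fin p → Fin n) → ℝ) where
  toFun w I := w (fun k => std (I k))
  map_add' _ _ := rfl
  map_smul' _ _ := rfl

theorem components_injective : Function.Injective (components n p) := fun _ _ h =>
  form_ext fun I => congrFun h I

/-- Finite dimension makes linear and bilinear maps on forms continuous, hence smooth; the calculus
below relies on this. -/
instance : FiniteDimensional ℝ ((Coord n) [⋀^Fin p]→L[ℝ] ℝ) :=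
  Module.Finite.of_injective (components n p) components_injective

/-- The component map is injective and linear, so it has a linear left inverse, and both maps are
smooth in finite dimension. -/
theorem contDiffOn_form_iff {E : Type*} [NormedAddCommGroup E] [NormedSpace ℝ E] {m : ℕ∞ω}
    {f : E → (Coord n) [⋀^Fin p]→L[ℝ] ℝ} {s : Set E} :
    ContDiffOn ℝ m f s ↔ ∀ I : Fin p → Fin n, ContDiffOn ℝ m (fun y => f y fun k => std (I k)) s := by
  have e := ContinuousLinearEquiv.ofFinrankEq
    (E := (Coord n) [⋀^Fin p]→L[ℝ] ℝ) (F := LinearMap.range (components n p)) (𝕜 := ℝ)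
    (LinearMap.finrank_range_of_inj components_injective).symm
  obtain ⟨L, hL⟩ := (components n p).exists_leftInverse_of_injective
    (LinearMap.ker_eq_bot.2 components_injective)
  constructor
  · intro h I
    exact ((LinearMap.toContinuousLinearMap
      ((LinearMap.proj I).comp (components n p))).contDiff.comp_contDiffOn h)
  · intro h
    have h1 : ContDiffOn ℝ m (fun y => components n p (f y)) s := contDiffOn_pi.2 h
    have h2 := (LinearMap.toContinuousLinearMap L).contDiff.comp_contDiffOn h1
    refine h2.congr fun y _ => ?_
    exact (LinearMap.congr_fun hL (f y)).symm

/-! ### The wedge product -/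

section Wedge

variable {V W : Type*} [AddCommGroup V] [Module ℝ V] [TopologicalSpace V]
  [AddCommGroup W] [Module ℝ W] [TopologicalSpace W]

theorem wedge_apply (h : p + q = r) (a : V [⋀^Fin p]→L[ℝ] ℝ) (b : V [⋀^Fin q]→L[ℝ] ℝ)
    (v : Fin r → V) :
    wedge h a b v = ((p ! : ℝ) * (q ! : ℝ))⁻¹ * ∑ σ : Equiv.Perm (Fin r),
      ((Equiv.Perm.sign σ : ℤ) : ℝ) *
        (a (fun i => v (σ (Fin.cast h (Fin.castAdd q i)))) *
          b (fun j => v (σ (Fin.cast h (Fin.natAdd p j))))) := by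
  simp only [wedge, ContinuousAlternatingMap.smul_apply, smul_eq_mul,
    ContinuousMultilinearMap.alternatization_apply_apply]
  congr 1
  refine Finset.sum_congr rfl fun σ _ => ?_
  rw [Units.smul_def, zsmul_eq_mul]
  rfl

theorem wedge_compContinuousLinearMap (h : p + q = r) (a : V [⋀^Fin p]→L[ℝ] ℝ)
    (b : V [⋀^Fin q]→L[ℝ] ℝ) (f : W →L[ℝ] V) :
    wedge h (a.compContinuousLinearMap f) (b.compContinuousLinearMap f) =
      (wedge h a b).compContinuousLinearMap f := by
  ext v
  simp only [wedge_apply, ContinuousAlternatingMap.compContinuousLinearMap_apply]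
  rfl

theorem wedge_add_left (h : p + q = r) (a a' : V [⋀^Fin p]→L[ℝ] ℝ) (b : V [⋀^Fin q]→L[ℝ] ℝ) :
    wedge h (a + a') b = wedge h a b + wedge h a' b := by
  ext v
  simp only [wedge_apply, ContinuousAlternatingMap.add_apply, add_mul, mul_add,
    Finset.sum_add_distrib]

theorem wedge_add_right (h : p + q = r) (a : V [⋀^Fin p]→L[ℝ] ℝ) (b b' : V [⋀^Fin q]→L[ℝ] ℝ) :
    wedge h a (b + b') = wedge h a b + wedge h a b' := by
  ext v
  simp only [wedge_apply, ContinuousAlternatingMap.add_apply, mul_add,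
    Finset.sum_add_distrib]

theorem wedge_smul_left (h : p + q = r) (c : ℝ) (a : V [⋀^Fin p]→L[ℝ] ℝ)
    (b : V [⋀^Fin q]→L[ℝ] ℝ) : wedge h (c • a) b = c • wedge h a b := by
  ext v
  simp only [wedge_apply, ContinuousAlternatingMap.smul_apply, smul_eq_mul, Finset.mul_sum]
  exact Finset.sum_congr rfl fun σ _ => by ring

theorem wedge_smul_right (h : p + q = r) (c : ℝ) (a : V [⋀^Fin p]→L[ℝ] ℝ)
    (b : V [⋀^Fin q]→L[ℝ] ℝ) : wedge h a (c • b) = c • wedge h a b := by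
  ext v
  simp only [wedge_apply, ContinuousAlternatingMap.smul_apply, smul_eq_mul, Finset.mul_sum]
  exact Finset.sum_congr rfl fun σ _ => by ring

/-- The wedge product as a bilinear map. -/
def wedgeₗ (h : p + q = r) :
    V [⋀^Fin p]→L[ℝ] ℝ →ₗ[ℝ] V [⋀^Fin q]→L[ℝ] ℝ →ₗ[ℝ] V [⋀^Fin r]→L[ℝ] ℝ :=
  LinearMap.mk₂ ℝ (wedge h) (wedge_add_left h) (wedge_smul_left h) (wedge_add_right h)
    (wedge_smul_right h)

/-- A permutation of `Fin (p + 1)` amounts to the image `i` of `0` and a permutation `τ` of the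
rest. For fixed `i` all $p!$ choices of `τ` give the same term, which cancels the factor $1/p!$. -/
theorem wedge_one_left_apply (a : V [⋀^Fin 1]→L[ℝ] ℝ) (b : V [⋀^Fin p]→L[ℝ] ℝ)
    (v : Fin (p + 1) → V) :
    wedge (Nat.add_comm 1 p) a b v =
      ∑ i : Fin (p + 1), (-1) ^ (i : ℕ) * (a (fun _ => v i) * b (i.removeNth v)) := by
  have key : ∀ i : Fin (p + 1), ∀ τ : Equiv.Perm (Fin p),
      ((Equiv.Perm.sign (Equiv.Perm.decomposeFin.symm (i, τ)) : ℤ) : ℝ) *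
        (a (fun k => v (Equiv.Perm.decomposeFin.symm (i, τ)
            (Fin.cast (Nat.add_comm 1 p) (Fin.castAdd p k)))) *
          b (fun j => v (Equiv.Perm.decomposeFin.symm (i, τ)
            (Fin.cast (Nat.add_comm 1 p) (Fin.natAdd 1 j))))) =
        (-1) ^ (i : ℕ) * (a (fun _ => v i) * b (i.removeNth v)) := by
    intro i τ
    have hcast : ∀ j : Fin p, Fin.cast (Nat.add_comm 1 p) (Fin.natAdd 1 j) = j.succ := by
      intro j; ext; simp
    have hzero : ∀ k : Fin 1, Fin.cast (Nat.add_comm 1 p) (Fin.castAdd p k) = 0 := by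
      intro k; ext; simp
    simp only [hcast, hzero, Equiv.Perm.decomposeFin_symm_apply_zero,
      Equiv.Perm.decomposeFin_symm_apply_succ, Equiv.Perm.decomposeFin.symm_sign]
    have hsign : ∀ ρ : Equiv.Perm (Fin p), ∀ u : Fin p → V,
        b (fun j => u (ρ j)) = ((Equiv.Perm.sign ρ : ℤ) : ℝ) * b u := by
      intro ρ u
      have := b.toAlternatingMap.map_perm u ρ
      rw [Units.smul_def, zsmul_eq_mul] at this
      exact this
    have hsq : ((Equiv.Perm.sign τ : ℤ) : ℝ) * ((Equiv.Perm.sign τ : ℤ) : ℝ) = 1 := by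
      rcases Int.units_eq_one_or (Equiv.Perm.sign τ) with h | h <;> simp [h]
    induction i using Fin.cases with
    | zero =>
      have h0 : b (fun j => v (Equiv.swap 0 0 (τ j).succ)) =
          ((Equiv.Perm.sign τ : ℤ) : ℝ) * b ((0 : Fin (p + 1)).removeNth v) := by
        rw [← hsign τ]
        simp [Fin.removeNth]
      rw [h0]
      simp only [if_true, one_mul, Fin.val_zero, pow_zero]
      linear_combination (a (fun _ => v 0) * b ((0 : Fin (p + 1)).removeNth v)) * hsq
    | succ i =>
      -- The transposition lists the remaining indices in a different order from `removeNth`; the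
      -- two orders differ by the cycle `i.cycleRange`. Its sign $(-1)^i$ and the sign $-1$ of the
      -- transposition make up $(-1)^{i+1}$.
      have h0 : b (fun j => v (Equiv.swap 0 i.succ (τ j).succ)) =
          ((Equiv.Perm.sign (i.cycleRange * τ) : ℤ) : ℝ) * b (i.succ.removeNth v) := by
        rw [← hsign (i.cycleRange * τ)]
        simp only [Fin.removeNth, Equiv.Perm.mul_apply, Fin.succAbove_cycleRange]
      rw [h0]
      simp only [Fin.succ_ne_zero, if_false, Fin.val_succ, pow_succ, map_mul, Fin.sign_cycleRange]
      push_cast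
      linear_combination ((-1) ^ (i : ℕ) * (-1) * a (fun _ => v i.succ) *
        b (i.succ.removeNth v)) * hsq
  rw [wedge_apply, ← Equiv.sum_comp Equiv.Perm.decomposeFin.symm, Fintype.sum_prod_type]
  simp only [key, Finset.sum_const, Finset.card_univ, Fintype.card_perm, Fintype.card_fin,
    nsmul_eq_mul, ← Finset.mul_sum, Nat.factorial_one, Nat.cast_one, one_mul]
  rw [← mul_assoc, inv_mul_cancel₀ (by positivity), one_mul]

end Wedge

/-! ### The interior product -/

section Interior

variable {V W : Type*} [AddCommGroup V] [Module ℝ V] [TopologicalSpace V]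
  [AddCommGroup W] [Module ℝ W] [TopologicalSpace W]

theorem interiorProd_succ_apply (x : V) (w : V [⋀^Fin (p + 1)]→L[ℝ] ℝ) (v : Fin p → V) :
    interiorProd x w v = w (Fin.cons x v) := rfl

theorem interiorProd_zero (x : V) (w : V [⋀^Fin 0]→L[ℝ] ℝ) : interiorProd x w = 0 := rfl

theorem interiorProd_compContinuousLinearMap (f : W →L[ℝ] V) (x : W) :
    ∀ {p : ℕ} (w : V [⋀^Fin p]→L[ℝ] ℝ), interiorProd x (w.compContinuousLinearMap f) =
      (interiorProd (f x) w).compContinuousLinearMap f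
  | 0, w => by
    ext v
    simp [interiorProd_zero]
  | p + 1, w => by
    ext v
    change w (f ∘ Fin.cons x v) = w (Fin.cons (f x) (f ∘ v))
    congr 1
    funext k
    cases k using Fin.cases <;> simp

/-- Degree zero stands apart in the antiderivation rule: since `0 - 1 = 0`, the term `a ∧ i_x b`
would have the wrong degree. -/
theorem interiorProd_wedge_one_zero (x : V) (a : V [⋀^Fin 1]→L[ℝ] ℝ) (b : V [⋀^Fin 0]→L[ℝ] ℝ) :
    interiorProd x (wedge (Nat.add_comm 1 0) a b) = a (fun _ => x) • b := by
  ext v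
  rw [interiorProd_succ_apply, wedge_one_left_apply]
  rw [Fin.sum_univ_succ, Fin.sum_univ_zero]
  simp only [Fin.val_zero, pow_zero, one_mul, add_zero, ContinuousAlternatingMap.smul_apply,
    smul_eq_mul, Fin.cons_zero]
  congr 2

/-- In the expansion of the wedge the term `i = 0` feeds `x` to `a`; in the others `x` stays in the
first slot of `b`, and the shift of index by one produces the minus sign. -/
theorem interiorProd_wedge_one_succ (x : V) (a : V [⋀^Fin 1]→L[ℝ] ℝ)
    (b : V [⋀^Fin (p + 1)]→L[ℝ] ℝ) :
    interiorProd x (wedge (Nat.add_comm 1 (p + 1)) a b) =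
      a (fun _ => x) • b - wedge (Nat.add_comm 1 p) a (interiorProd x b) := by
  ext v
  rw [interiorProd_succ_apply, wedge_one_left_apply, Fin.sum_univ_succ,
    ContinuousAlternatingMap.sub_apply, ContinuousAlternatingMap.smul_apply,
    wedge_one_left_apply, sub_eq_add_neg, ← Finset.sum_neg_distrib]
  congr 1
  · simp
  · refine Finset.sum_congr rfl fun i _ => ?_
    have h : i.succ.removeNth (Fin.cons x v : Fin (p + 2) → V) =
        Fin.cons x (i.removeNth v) := by
      funext k
      cases k using Fin.cases <;> simp [Fin.removeNth]
    rw [h, Fin.cons_succ, interiorProd_succ_apply, Fin.val_succ, pow_succ]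
    ring

end Interior

/-! ### Forms of top degree -/

theorem coordVol_apply (v : Fin n → Coord n) :
    coordVol n v = Matrix.det (Matrix.of fun i j => v i j) := rfl

theorem coordVol_std : coordVol n std = 1 := by
  rw [coordVol_apply, ← Matrix.det_one (n := Fin n)]
  congr 1
  ext i j
  simp [std_apply, Matrix.one_apply, eq_comm]

theorem coordVol_std_perm (σ : Equiv.Perm (Fin n)) :
    coordVol n (fun k => std (σ k)) = ((Equiv.Perm.sign σ : ℤ) : ℝ) := by
  have := (coordVol n).toAlternatingMap.map_perm std σ
  rw [Units.smul_def, zsmul_eq_mul] at this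
  refine this.trans ?_
  change _ * coordVol n std = _
  rw [coordVol_std, mul_one]

/-- An alternating map is determined by its values on injective families of basis vectors, and with
`n` slots these are permutations of the basis. -/
theorem top_form_ext {w η : (Coord n) [⋀^Fin n]→L[ℝ] ℝ} (h : w std = η std) : w = η := by
  refine ContinuousAlternatingMap.toAlternatingMap_injective
    ((EuclideanSpace.basisFun (Fin n) ℝ).toBasis.ext_alternating fun I hI => ?_)
  obtain ⟨σ, rfl⟩ : ∃ σ : Equiv.Perm (Fin n), I = σ :=
    ⟨Equiv.ofBijective I (Finite.injective_iff_bijective.1 hI), rfl⟩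
  simp only [basisFun_toBasis_apply]
  have h1 := w.toAlternatingMap.map_perm std σ
  have h2 := η.toAlternatingMap.map_perm std σ
  refine h1.trans (Eq.trans ?_ h2.symm)
  exact congrArg _ h

theorem top_form_eq (w : (Coord n) [⋀^Fin n]→L[ℝ] ℝ) : w = w std • coordVol n :=
  top_form_ext (by simp [coordVol_std])

theorem form_eq_zero_of_lt (h : n < p) (w : (Coord n) [⋀^Fin p]→L[ℝ] ℝ) : w = 0 := by
  refine form_ext fun I => ?_
  have : ¬ Function.Injective I := fun hI => by
    have := Fintype.card_le_of_injective I hI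
    simp at this
    omega
  simp only [Function.Injective, not_forall] at this
  obtain ⟨i, j, hij, hne⟩ := this
  exact w.map_eq_zero_of_eq _ (by rw [hij]) hne

end CoordForms


/-! ### The inner product of forms -/

section Inner

variable {n p q : ℕ}

/-- The matrix of an endomorphism of the coordinate space. -/
def coordMatrix (B : Coord n →L[ℝ] Coord n) : Matrix (Fin n) (Fin n) ℝ :=
  Matrix.of fun i j => B (std j) i

theorem map_std_eq_sum (B : Coord n →L[ℝ] Coord n) (j : Fin n) :
    B (std j) = ∑ i, coordMatrix B i j • std i :=
  (sum_smul_std _).symm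

theorem toMatrix_eq_coordMatrix (B : Coord n →L[ℝ] Coord n) :
    LinearMap.toMatrix (EuclideanSpace.basisFun (Fin n) ℝ).toBasis
      (EuclideanSpace.basisFun (Fin n) ℝ).toBasis (B : Coord n →ₗ[ℝ] Coord n) = coordMatrix B := by
  ext i j
  rw [LinearMap.toMatrix_apply, basisFun_toBasis_apply]
  simp [coordMatrix]

theorem det_coordMatrix (B : Coord n →L[ℝ] Coord n) : (coordMatrix B).det = B.det := by
  rw [ContinuousLinearMap.det, ← toMatrix_eq_coordMatrix, LinearMap.det_toMatrix]

theorem exists_coordMatrix_eq (A : Matrix (Fin n) (Fin n) ℝ) :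
    ∃ B : Coord n →L[ℝ] Coord n, coordMatrix B = A := by
  refine ⟨LinearMap.toContinuousLinearMap
    (Matrix.toLin (EuclideanSpace.basisFun (Fin n) ℝ).toBasis
      (EuclideanSpace.basisFun (Fin n) ℝ).toBasis A), ?_⟩
  rw [← toMatrix_eq_coordMatrix]
  exact LinearMap.toMatrix_toLin _ _ A

/-- The pairing `H^{i₁j₁} ⋯ H^{i_pj_p} w_{i₁…i_p} η_{j₁…j_p}` of `p`-forms. -/
def pairing (H : Matrix (Fin n) (Fin n) ℝ) (w η : (Coord n) [⋀^Fin p]→L[ℝ] ℝ) : ℝ :=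
  ∑ I : Fin p → Fin n, ∑ J : Fin p → Fin n,
    (∏ k, H (I k) (J k)) * w (fun k => std (I k)) * η (fun k => std (J k))

theorem coordInner_eq_pairing (G : Matrix (Fin n) (Fin n) ℝ) (w η : (Coord n) [⋀^Fin p]→L[ℝ] ℝ) :
    coordInner G w η = (p ! : ℝ)⁻¹ * pairing G⁻¹ w η := rfl

theorem coordInner_add_left (G : Matrix (Fin n) (Fin n) ℝ) (w w' η : (Coord n) [⋀^Fin p]→L[ℝ] ℝ) :
    coordInner G (w + w') η = coordInner G w η + coordInner G w' η := by
  simp only [coordInner, ContinuousAlternatingMap.add_apply, mul_add, add_mul,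
    Finset.sum_add_distrib]

theorem coordInner_smul_left (G : Matrix (Fin n) (Fin n) ℝ) (c : ℝ)
    (w η : (Coord n) [⋀^Fin p]→L[ℝ] ℝ) : coordInner G (c • w) η = c * coordInner G w η := by
  simp only [coordInner, ContinuousAlternatingMap.smul_apply, smul_eq_mul, Finset.mul_sum]
  exact Finset.sum_congr rfl fun I _ => Finset.sum_congr rfl fun J _ => by ring

theorem coordInner_comm {G : Matrix (Fin n) (Fin n) ℝ} (hG : G.transpose = G)
    (w η : (Coord n) [⋀^Fin p]→L[ℝ] ℝ) : coordInner G w η = coordInner G η w := by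
  have h : ∀ i j, G⁻¹ i j = G⁻¹ j i := fun i j => by
    conv_lhs => rw [← hG, ← Matrix.transpose_nonsing_inv, Matrix.transpose_apply]
  unfold coordInner
  rw [Finset.sum_comm]
  congr 1
  refine Finset.sum_congr rfl fun I _ => Finset.sum_congr rfl fun J _ => ?_
  rw [Finset.prod_congr rfl fun k _ => h (J k) (I k)]
  ring

theorem sum_sum_prod_eq_prod_sum_sum (f : Fin p → Fin n → Fin n → ℝ) :
    ∑ I : Fin p → Fin n, ∑ J : Fin p → Fin n, ∏ k, f k (I k) (J k) =
      ∏ k, ∑ i, ∑ j, f k i j := by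
  rw [Finset.prod_univ_sum, Fintype.piFinset_univ]
  refine Finset.sum_congr rfl fun I _ => ?_
  rw [Finset.prod_univ_sum, Fintype.piFinset_univ]

/-- Multilinear expansion of both forms puts a factor `B` at each end of every `H (I k) (J k)`.
Summing over `I` and `J` slot by slot turns these into matrix products. -/
theorem pairing_compContinuousLinearMap (H : Matrix (Fin n) (Fin n) ℝ)
    (w η : (Coord n) [⋀^Fin p]→L[ℝ] ℝ) (B : Coord n →L[ℝ] Coord n) :
    pairing H (w.compContinuousLinearMap B) (η.compContinuousLinearMap B) =
      pairing (coordMatrix B * H * (coordMatrix B).transpose) w η := by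
  have hw : ∀ (w : (Coord n) [⋀^Fin p]→L[ℝ] ℝ) (I : Fin p → Fin n),
      w.compContinuousLinearMap B (fun k => std (I k)) =
        ∑ K : Fin p → Fin n, (∏ k, coordMatrix B (K k) (I k)) * w (fun k => std (K k)) := by
    intro w I
    refine Eq.trans ?_ (apply_sum_smul_std w fun k i => coordMatrix B i (I k))
    simp only [← map_std_eq_sum]
    rfl
  have hprod : ∀ K L : Fin p → Fin n,
      ∏ k, (coordMatrix B * H * (coordMatrix B).transpose) (K k) (L k) =
        ∑ I : Fin p → Fin n, ∑ J : Fin p → Fin n,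
          ∏ k, (coordMatrix B (K k) (I k) * H (I k) (J k) * coordMatrix B (L k) (J k)) := by
    intro K L
    rw [sum_sum_prod_eq_prod_sum_sum
      (fun k i j => coordMatrix B (K k) i * H i j * coordMatrix B (L k) j)]
    refine Finset.prod_congr rfl fun k _ => ?_
    rw [Matrix.mul_apply, Finset.sum_comm]
    refine Finset.sum_congr rfl fun j _ => ?_
    rw [Matrix.mul_apply, Finset.sum_mul]
    rfl
  simp only [pairing, hw, hprod, Finset.prod_mul_distrib, Finset.sum_mul, Finset.mul_sum]
  trans ∑ I : Fin p → Fin n, ∑ J : Fin p → Fin n, ∑ K : Fin p → Fin n, ∑ L : Fin p → Fin n,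
    (∏ k, coordMatrix B (K k) (I k)) * (∏ k, H (I k) (J k)) *
      (∏ k, coordMatrix B (L k) (J k)) * w (fun k => std (K k)) * η (fun k => std (L k))
  · refine Finset.sum_congr rfl fun I _ => Finset.sum_congr rfl fun J _ => ?_
    rw [Finset.sum_comm]
    exact Finset.sum_congr rfl fun K _ => Finset.sum_congr rfl fun L _ => by ring
  · simp only [← Finset.sum_product']
    -- Exchange the pair of summation variables `(I, J)` with `(K, L)`.
    refine Finset.sum_nbij' (fun x => (x.2.2.1, x.2.2.2, x.1, x.2.1))
      (fun x => (x.2.2.1, x.2.2.2, x.1, x.2.1)) ?_ ?_ ?_ ?_ ?_ <;> simp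

/-- This is the coordinate invariance of the inner product: the inverse of $B^TGB$ is
$B^{-1}G^{-1}B^{-T}$, and pulling back the forms contributes exactly the factors that cancel. -/
theorem coordInner_compContinuousLinearMap (G : Matrix (Fin n) (Fin n) ℝ)
    (w η : (Coord n) [⋀^Fin p]→L[ℝ] ℝ) {B : Coord n →L[ℝ] Coord n} (hB : B.det ≠ 0) :
    coordInner ((coordMatrix B).transpose * G * coordMatrix B)
      (w.compContinuousLinearMap B) (η.compContinuousLinearMap B) = coordInner G w η := by
  have hu : IsUnit (coordMatrix B).det := by rwa [isUnit_iff_ne_zero, det_coordMatrix]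
  have hu' : IsUnit (coordMatrix B).transpose.det := by rwa [Matrix.det_transpose]
  rw [coordInner_eq_pairing, coordInner_eq_pairing, pairing_compContinuousLinearMap,
    Matrix.mul_inv_rev, Matrix.mul_inv_rev, Matrix.mul_nonsing_inv_cancel_left _ _ hu,
    Matrix.nonsing_inv_mul_cancel_right _ _ hu']

theorem pairing_one_self (w : (Coord n) [⋀^Fin p]→L[ℝ] ℝ) :
    pairing 1 w w = ∑ I : Fin p → Fin n, w (fun k => std (I k)) ^ 2 := by
  refine Finset.sum_congr rfl fun I _ => ?_
  rw [Finset.sum_eq_single I]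
  · simp [sq]
  · intro J _ hJ
    obtain ⟨k, hk⟩ := Function.ne_iff.1 hJ
    rw [Finset.prod_eq_zero (Finset.mem_univ k) (by simp [Ne.symm hk]), zero_mul,
      zero_mul]
  · simp

open scoped MatrixOrder in
theorem exists_eq_transpose_mul_self {H : Matrix (Fin n) (Fin n) ℝ} (hH : H.PosSemidef) :
    ∃ A : Matrix (Fin n) (Fin n) ℝ, H = A.transpose * A := by
  obtain ⟨A, hA⟩ := CStarAlgebra.nonneg_iff_eq_star_mul_self.1 hH.nonneg
  exact ⟨A, by rw [hA, Matrix.star_eq_conjTranspose,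
    Matrix.conjTranspose_eq_transpose_of_trivial]⟩

/-- With $G^{-1}=BB^T$, the map `B` carries the standard basis to a `G`-orthonormal one, in which
the norm is a sum of squares of components. Definiteness follows. -/
theorem exists_coordInner_self_eq {G : Matrix (Fin n) (Fin n) ℝ} (hG : G.PosDef) :
    ∃ B : Coord n →L[ℝ] Coord n, B.det ≠ 0 ∧ ∀ w : (Coord n) [⋀^Fin p]→L[ℝ] ℝ,
      coordInner G w w = (p ! : ℝ)⁻¹ *
        ∑ I : Fin p → Fin n, w.compContinuousLinearMap B (fun k => std (I k)) ^ 2 := by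
  obtain ⟨A, hA⟩ := exists_eq_transpose_mul_self hG.inv.posSemidef
  obtain ⟨B, hB⟩ := exists_coordMatrix_eq A.transpose
  have hA' : G⁻¹ = coordMatrix B * 1 * (coordMatrix B).transpose := by
    rw [hB, hA, mul_one, Matrix.transpose_transpose]
  refine ⟨B, fun h0 => ?_, fun w => ?_⟩
  · have := hG.inv.det_pos
    rw [hA', Matrix.det_mul, Matrix.det_mul, det_coordMatrix, h0] at this
    simp at this
  · rw [coordInner_eq_pairing, hA', ← pairing_compContinuousLinearMap, pairing_one_self]

theorem coordInner_self_nonneg {G : Matrix (Fin n) (Fin n) ℝ} (hG : G.PosDef)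
    (w : (Coord n) [⋀^Fin p]→L[ℝ] ℝ) : 0 ≤ coordInner G w w := by
  obtain ⟨B, -, hB⟩ := exists_coordInner_self_eq (p := p) hG
  rw [hB]
  positivity

theorem coordInner_self_eq_zero {G : Matrix (Fin n) (Fin n) ℝ} (hG : G.PosDef)
    {w : (Coord n) [⋀^Fin p]→L[ℝ] ℝ} (h : coordInner G w w = 0) : w = 0 := by
  obtain ⟨B, hdet, hB⟩ := exists_coordInner_self_eq (p := p) hG
  rw [hB, mul_eq_zero, or_iff_right (by positivity),
    Finset.sum_eq_zero_iff_of_nonneg fun _ _ => sq_nonneg _] at h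
  have h0 : w.compContinuousLinearMap B = 0 := form_ext fun I => by
    simpa using h I (Finset.mem_univ I)
  ext v
  have hs : Function.Surjective B := by
    have := (LinearMap.equivOfDetNeZero (B : Coord n →ₗ[ℝ] Coord n) hdet).surjective
    exact this
  choose u hu using fun k => hs (v k)
  have := DFunLike.congr_fun h0 u
  rw [ContinuousAlternatingMap.compContinuousLinearMap_apply] at this
  rwa [show v = B ∘ u from funext fun k => (hu k).symm]

/-- The vector `x` is `a` with its index raised. In the term of the wedge where `a` occupies slot
`m`, moving slot `m` of `w` to the front costs $(-1)^m$, which cancels the sign in the wedge;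
contraction then inserts `x`. All `p + 1` slots contribute equally, which turns $1/(p+1)!$ into
$1/p!$. -/
theorem coordInner_wedge_one (G : Matrix (Fin n) (Fin n) ℝ) (a : (Coord n) [⋀^Fin 1]→L[ℝ] ℝ)
    (η : (Coord n) [⋀^Fin p]→L[ℝ] ℝ) (w : (Coord n) [⋀^Fin (p + 1)]→L[ℝ] ℝ) (x : Coord n)
    (hx : ∀ j, x j = ∑ i, G⁻¹ i j * a (fun _ => std i)) :
    coordInner G (wedge (Nat.add_comm 1 p) a η) w = coordInner G η (interiorProd x w) := by
  have key : ∀ m : Fin (p + 1), ∑ I : Fin (p + 1) → Fin n, ∑ J : Fin (p + 1) → Fin n,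
      (∏ k, G⁻¹ (I k) (J k)) * ((-1) ^ (m : ℕ) * (a (fun _ => std (I m)) *
        η (m.removeNth fun k => std (I k)))) * w (fun k => std (J k)) =
      ∑ I : Fin p → Fin n, ∑ J : Fin p → Fin n,
        (∏ k, G⁻¹ (I k) (J k)) * η (fun k => std (I k)) *
          interiorProd x w (fun k => std (J k)) := by
    intro m
    have hw : ∀ (b : Fin n) (J : Fin p → Fin n),
        w (fun k => std ((Fin.insertNthEquiv (fun _ => Fin n) m) (b, J) k)) =
          (-1) ^ (m : ℕ) * w (Fin.cons (std b) fun k => std (J k)) := by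
      intro b J
      have h1 := w.toAlternatingMap.map_insertNth m (std b) (fun k => std (J k))
      have h2 : (fun k => (std ((Fin.insertNthEquiv (fun _ => Fin n) m) (b, J) k) : Coord n)) =
          m.insertNth (std b) (fun k => std (J k)) := by
        funext k
        cases k using m.succAboveCases <;> simp
      rw [h2]
      simpa [Matrix.vecCons] using h1
    have hx' : ∀ v : Fin p → Coord n, interiorProd x w v =
        ∑ i, ∑ j, G⁻¹ i j * a (fun _ => std i) * w (Fin.cons (std j) v) := by
      intro v
      rw [Finset.sum_comm]
      simp only [← Finset.sum_mul, ← hx]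
      calc interiorProd x w v = w.curryLeft (∑ j, x j • std j) v := by rw [sum_smul_std]; rfl
        _ = ∑ j, x j * w (Fin.cons (std j) v) := by
          simp only [map_sum, map_smul, ContinuousAlternatingMap.sum_apply,
            ContinuousAlternatingMap.smul_apply, smul_eq_mul]
          rfl
    -- Split the multi-index `I` into its `m`-th entry and the rest; the same is done to `J` below.
    rw [← Equiv.sum_comp (Fin.insertNthEquiv (fun _ => Fin n) m), Fintype.sum_prod_type,
      Finset.sum_comm]
    refine Finset.sum_congr rfl fun I _ => ?_
    simp only [hx', Finset.mul_sum]
    conv_rhs => rw [Finset.sum_comm]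
    refine Finset.sum_congr rfl fun i _ => ?_
    rw [← Equiv.sum_comp (Fin.insertNthEquiv (fun _ => Fin n) m), Fintype.sum_prod_type,
      Finset.sum_comm]
    refine Finset.sum_congr rfl fun J _ => Finset.sum_congr rfl fun j _ => ?_
    rw [hw, Fin.prod_univ_succAbove _ m]
    have hsq : ((-1 : ℝ) ^ (m : ℕ)) * (-1) ^ (m : ℕ) = 1 := by
      rw [← mul_pow]; simp
    have hη : η (m.removeNth fun k =>
        std ((Fin.insertNthEquiv (fun _ => Fin n) m) (i, I) k)) = η fun k => std (I k) := by
      congr 1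
      funext k
      simp [Fin.removeNth]
    rw [hη]
    simp only [Fin.insertNthEquiv_apply, Fin.insertNth_apply_same, Fin.insertNth_apply_succAbove]
    have alg : ∀ s A B C D E : ℝ, s * s = 1 →
        A * B * (s * (C * D)) * (s * E) = B * D * (A * C * E) := by
      intro s A B C D E hs
      linear_combination A * B * C * D * E * hs
    exact alg _ _ _ _ _ _ hsq
  have hsum : ∑ I : Fin (p + 1) → Fin n, ∑ J : Fin (p + 1) → Fin n,
      (∏ k, G⁻¹ (I k) (J k)) * wedge (Nat.add_comm 1 p) a η (fun k => std (I k)) *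
        w (fun k => std (J k)) =
      (p + 1 : ℕ) * ∑ I : Fin p → Fin n, ∑ J : Fin p → Fin n,
        (∏ k, G⁻¹ (I k) (J k)) * η (fun k => std (I k)) *
          interiorProd x w (fun k => std (J k)) := by
    rw [← nsmul_eq_mul]
    refine Eq.trans ?_ ((Finset.sum_congr rfl fun m _ => key m).trans
      ((Finset.sum_const _).trans (by rw [Finset.card_univ, Fintype.card_fin])))
    conv_rhs => rw [Finset.sum_comm]
    refine Finset.sum_congr rfl fun I _ => ?_
    conv_rhs => rw [Finset.sum_comm]
    refine Finset.sum_congr rfl fun J _ => ?_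
    rw [wedge_one_left_apply, Finset.mul_sum, Finset.sum_mul]
  unfold coordInner
  rw [hsum, ← mul_assoc, Nat.factorial_succ]
  congr 1
  push_cast
  field_simp

/-! ### The Hodge star -/

/-- The first block of vectors is arranged by `J` alone and the second by `J` and `τ`, so the
determinant has the sign of `J` times that of `τ`. Against the sign of `J * e` only the sign of `ρ`
is left. -/
theorem coordVol_append_std_perm {J : Equiv.Perm (Fin (p + q))} (ρ : Equiv.Perm (Fin p))
    (τ : Equiv.Perm (Fin q)) (e : Equiv.Perm (Fin (p + q)))
    (he : e = finSumFinEquiv.permCongr (Equiv.Perm.sumCongr ρ τ)) :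
    ((Equiv.Perm.sign (J * e) : ℤ) : ℝ) * coordVol (p + q)
      (Fin.append (fun i => std (J (Fin.castAdd q i)))
        fun j => std ((J * e) (Fin.natAdd p j))) = ((Equiv.Perm.sign ρ : ℤ) : ℝ) := by
  subst he
  have h1 : (Fin.append (fun i => std (J (Fin.castAdd q i)))
        fun j => std ((J * finSumFinEquiv.permCongr (Equiv.Perm.sumCongr ρ τ)) (Fin.natAdd p j)) :
        Fin (p + q) → Coord (p + q)) =
      fun k => std ((J * finSumFinEquiv.permCongr (Equiv.Perm.sumCongr 1 τ) :
        Equiv.Perm (Fin (p + q))) k) := by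
    funext k
    cases k using Fin.addCases <;> simp
  have hsq : ∀ {m : ℕ} (σ : Equiv.Perm (Fin m)),
      ((Equiv.Perm.sign σ : ℤ) : ℝ) * ((Equiv.Perm.sign σ : ℤ) : ℝ) = 1 := by
    intro m σ
    rcases Int.units_eq_one_or (Equiv.Perm.sign σ) with h | h <;> simp [h]
  rw [h1, coordVol_std_perm]
  simp only [map_mul, Equiv.Perm.sign_permCongr, Equiv.Perm.sign_sumCongr, map_one, one_mul]
  push_cast
  linear_combination ((Equiv.Perm.sign ρ : ℤ) : ℝ) * ((Equiv.Perm.sign J : ℤ) : ℝ) *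
    ((Equiv.Perm.sign J : ℤ) : ℝ) * hsq τ + ((Equiv.Perm.sign ρ : ℤ) : ℝ) * hsq J

/-- A permutation that maps the last `q` indices into themselves does so bijectively, by finiteness;
hence it also preserves the first `p`. -/
theorem exists_perm_sumCongr {σ : Equiv.Perm (Fin (p + q))}
    (h : ∀ i j, σ (Fin.natAdd p j) ≠ Fin.castAdd q i) :
    ∃ ρ τ, σ = finSumFinEquiv.permCongr (Equiv.Perm.sumCongr ρ τ) := by
  have hmem : (finSumFinEquiv.symm.permCongr σ) ∈ (Equiv.Perm.sumCongrHom (Fin p) (Fin q)).range := by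
    have hr : ∀ j, ∃ j', σ (Fin.natAdd p j) = Fin.natAdd p j' := by
      intro j
      cases hk : σ (Fin.natAdd p j) using Fin.addCases with
      | left i => exact absurd hk (h i j)
      | right j' => exact ⟨j', rfl⟩
    choose f hf using hr
    have hinj : Function.Injective f := fun j₁ j₂ hj => by
      have := σ.injective ((hf j₁).trans ((congrArg _ hj).trans (hf j₂).symm))
      exact Fin.natAdd_injective _ _ this
    refine Equiv.Perm.mem_sumCongrHom_range_of_perm_mapsTo_inl ?_
    rintro _ ⟨i, rfl⟩
    cases hk : σ (Fin.castAdd q i) using Fin.addCases with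
    | left i' => exact ⟨i', by simp [Equiv.permCongr_apply, hk]⟩
    | right j =>
      obtain ⟨j', rfl⟩ := (Finite.injective_iff_surjective.1 hinj) j
      rw [← hf] at hk
      have := congrArg Fin.val (σ.injective hk)
      simp at this
      omega
  obtain ⟨⟨ρ, τ⟩, hρ⟩ := hmem
  refine ⟨ρ, τ, ?_⟩
  change Equiv.Perm.sumCongr ρ τ = _ at hρ
  rw [hρ]
  ext k
  simp [Equiv.permCongr_apply]

/-- The combinatorial core of the Hodge star. After translation by a permutation extending `J`, a
term of the wedge survives only if its permutation preserves the two blocks, as otherwise `coordVol`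
sees a repeated vector. Each of the $p!\,q!$ block permutations contributes `η (∂_J)`, which cancels
the normalising factor. -/
theorem wedge_insertLeft_coordVol (h : p + q = n) (η : (Coord n) [⋀^Fin p]→L[ℝ] ℝ)
    (J : Fin p → Fin n) :
    wedge h η (insertLeft h (coordVol n) fun k => std (J k)) =
      η (fun k => std (J k)) • coordVol n := by
  subst h
  have hins : ∀ v, insertLeft (p := p) (q := q) rfl (coordVol (p + q)) (fun k => std (J k)) v =
    coordVol (p + q) (Fin.append (fun k => std (J k)) v) := fun v => rfl
  refine top_form_ext ?_
  rw [ContinuousAlternatingMap.smul_apply, coordVol_std, wedge_apply, smul_eq_mul, mul_one]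
  simp only [hins, Fin.cast_refl, id]
  -- If `J` repeats an index, both sides vanish.
  by_cases hJ : Function.Injective J
  swap
  · simp only [Function.Injective, not_forall] at hJ
    obtain ⟨i, j, hij, hne⟩ := hJ
    rw [η.map_eq_zero_of_eq _ (by rw [hij]) hne, Finset.sum_eq_zero, mul_zero]
    intro σ _
    rw [(coordVol (p + q)).map_eq_zero_of_eq _ (i := Fin.castAdd q i) (j := Fin.castAdd q j),
      mul_zero, mul_zero]
    · simp [hij]
    · simpa using hne
  obtain ⟨τ, hτ⟩ : ∃ τ : Equiv.Perm (Fin (p + q)), ∀ i, τ (Fin.castAdd q i) = J i := by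
    let e := (Equiv.ofInjective _ (Fin.castAdd_injective p q)).symm.trans (Equiv.ofInjective J hJ)
    refine ⟨e.extendSubtype, fun i => ?_⟩
    rw [e.extendSubtype_apply_of_mem _ ⟨i, rfl⟩]
    have : (Equiv.ofInjective _ (Fin.castAdd_injective p q)).symm ⟨Fin.castAdd q i, i, rfl⟩ = i :=
      Equiv.ofInjective_symm_apply _ i
    simp only [e, Equiv.trans_apply]
    rw [this]
    rfl
  simp only [← hτ]
  rw [← Equiv.sum_comp (Equiv.mulLeft τ)]
  simp only [Equiv.coe_mulLeft]
  have hval : ∑ x : Equiv.Perm (Fin p) × Equiv.Perm (Fin q),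
      η (fun k => std (τ (Fin.castAdd q k))) = (p ! : ℝ) * (q ! : ℝ) *
        η (fun k => std (τ (Fin.castAdd q k))) := by
    rw [Finset.sum_const, Finset.card_univ, Fintype.card_prod, Fintype.card_perm,
      Fintype.card_perm, Fintype.card_fin, Fintype.card_fin, nsmul_eq_mul]
    push_cast
    ring
  rw [inv_mul_eq_iff_eq_mul₀ (by positivity), ← hval]
  symm
  refine Fintype.sum_of_injective
    (fun x : Equiv.Perm (Fin p) × Equiv.Perm (Fin q) =>
      finSumFinEquiv.permCongr (Equiv.Perm.sumCongr x.1 x.2)) ?_ _ _ ?_ ?_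
  · intro x y hxy
    exact Equiv.Perm.sumCongrHom_injective (finSumFinEquiv.permCongr.injective hxy)
  · intro σ hσ
    have : ∃ i j, σ (Fin.natAdd p j) = Fin.castAdd q i := by
      by_contra! hcon
      obtain ⟨ρ, τ', rfl⟩ := exists_perm_sumCongr hcon
      exact hσ ⟨(ρ, τ'), rfl⟩
    obtain ⟨i, j, hij⟩ := this
    rw [(coordVol (p + q)).map_eq_zero_of_eq _ (i := Fin.castAdd q i) (j := Fin.natAdd p j),
      mul_zero, mul_zero]
    · simp [hij]
    · simp only [ne_eq, Fin.ext_iff, Fin.val_castAdd, Fin.val_natAdd]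
      omega
  · rintro ⟨ρ, τ'⟩
    have h1 := coordVol_append_std_perm (J := τ) ρ τ' _ rfl
    have h2 : η (fun i => std ((τ * finSumFinEquiv.permCongr (Equiv.Perm.sumCongr ρ τ'))
        (Fin.castAdd q i))) = ((Equiv.Perm.sign ρ : ℤ) : ℝ) *
          η (fun i => std (τ (Fin.castAdd q i))) := by
      have := η.toAlternatingMap.map_perm (fun i => std (τ (Fin.castAdd q i))) ρ
      rw [Units.smul_def, zsmul_eq_mul] at this
      refine Eq.trans ?_ this
      simp [Function.comp_def]
    have hsq : ((Equiv.Perm.sign ρ : ℤ) : ℝ) * ((Equiv.Perm.sign ρ : ℤ) : ℝ) = 1 := by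
      rcases Int.units_eq_one_or (Equiv.Perm.sign ρ) with h | h <;> simp [h]
    rw [h2, mul_left_comm, h1]
    linear_combination (-η (fun i => std (τ (Fin.castAdd q i)))) * hsq

theorem insertLeft_smul (h : p + q = n) (c : ℝ) (μ : (Coord n) [⋀^Fin n]→L[ℝ] ℝ)
    (u : Fin p → Coord n) : insertLeft h (c • μ) u = c • insertLeft h μ u := rfl

/-- The normalisation of the Hodge star. -/
theorem wedge_coordStar (h : p + q = n) (G : Matrix (Fin n) (Fin n) ℝ)
    (η w : (Coord n) [⋀^Fin p]→L[ℝ] ℝ) :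
    wedge h η (coordStar h G w) = coordInner G w η • volForm G := by
  change wedgeₗ h η (coordStar h G w) = _
  simp only [coordStar, map_smul, map_sum, volForm, insertLeft_smul]
  simp only [wedgeₗ, LinearMap.mk₂_apply, wedge_insertLeft_coordVol]
  refine top_form_ext ?_
  simp only [ContinuousAlternatingMap.smul_apply, ContinuousAlternatingMap.sum_apply, smul_eq_mul,
    coordVol_std, mul_one, coordInner, Finset.mul_sum, Finset.sum_mul]
  exact Finset.sum_congr rfl fun I _ => Finset.sum_congr rfl fun J _ => by ring

/-! ### Change of coordinates -/

theorem top_form_comp (w : (Coord n) [⋀^Fin n]→L[ℝ] ℝ) (B : Coord n →L[ℝ] Coord n) :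
    w.compContinuousLinearMap B = B.det • w := by
  have h1 : (coordVol n).compContinuousLinearMap B = B.det • coordVol n := by
    refine top_form_ext ?_
    rw [ContinuousAlternatingMap.smul_apply, coordVol_std, smul_eq_mul, mul_one,
      ← det_coordMatrix, ← Matrix.det_transpose]
    rfl
  rw [top_form_eq w]
  ext v
  have := DFunLike.congr_fun h1 v
  simp only [ContinuousAlternatingMap.compContinuousLinearMap_apply,
    ContinuousAlternatingMap.smul_apply, smul_eq_mul] at this ⊢
  rw [this]
  ring

theorem sqrt_det_transpose_mul_mul (G : Matrix (Fin n) (Fin n) ℝ) (B : Coord n →L[ℝ] Coord n) :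
    √((coordMatrix B).transpose * G * coordMatrix B).det = |B.det| * √G.det := by
  rw [Matrix.det_mul, Matrix.det_mul, Matrix.det_transpose, det_coordMatrix,
    show B.det * G.det * B.det = B.det ^ 2 * G.det by ring, Real.sqrt_mul (sq_nonneg _),
    Real.sqrt_sq_eq_abs]

end Inner


section Calculus

variable {n p q r : ℕ}

/-! ### Differentiability of the algebraic operations -/

section Smoothness

variable {E : Type*} [NormedAddCommGroup E] [NormedSpace ℝ E] {m : ℕ∞ω} {s : Set E}

theorem contDiffOn_wedge (h : p + q = r) {a : E → (Coord n) [⋀^Fin p]→L[ℝ] ℝ}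
    {b : E → (Coord n) [⋀^Fin q]→L[ℝ] ℝ} (ha : ContDiffOn ℝ m a s) (hb : ContDiffOn ℝ m b s) :
    ContDiffOn ℝ m (fun y => wedge h (a y) (b y)) s := by
  let B := (wedgeₗ (V := Coord n) h).toContinuousBilinearMap
  have hB : ∀ y, wedge h (a y) (b y) = B (a y) (b y) := fun y => rfl
  simp only [hB]
  exact (B.contDiff.comp_contDiffOn ha).clm_apply hb

variable (n p) in
/-- The interior product as a bilinear map. -/
def interiorProdₗ : Coord n →ₗ[ℝ] (Coord n) [⋀^Fin p]→L[ℝ] ℝ →ₗ[ℝ] (Coord n) [⋀^Fin (p - 1)]→L[ℝ] ℝ :=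
  match p with
  | 0 => 0
  | p + 1 => LinearMap.mk₂ ℝ (fun x w => w.curryLeft x) (fun x y w => by simp)
    (fun c x w => by simp) (fun x w η => rfl) (fun c x w => rfl)

theorem interiorProdₗ_apply (x : Coord n) (w : (Coord n) [⋀^Fin p]→L[ℝ] ℝ) :
    interiorProdₗ n p x w = interiorProd x w := by
  cases p <;> rfl

theorem contDiffOn_interiorProd {ξ : E → Coord n} {w : E → (Coord n) [⋀^Fin p]→L[ℝ] ℝ}
    (hξ : ContDiffOn ℝ m ξ s) (hw : ContDiffOn ℝ m w s) :
    ContDiffOn ℝ m (fun y => interiorProd (ξ y) (w y)) s := by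
  simp only [← interiorProdₗ_apply]
  let B := (interiorProdₗ n p).toContinuousBilinearMap
  exact (B.contDiff.comp_contDiffOn hξ).clm_apply hw

theorem contDiffOn_det {G : E → Matrix (Fin n) (Fin n) ℝ}
    (hG : ∀ i j, ContDiffOn ℝ m (fun y => G y i j) s) : ContDiffOn ℝ m (fun y => (G y).det) s := by
  simp only [Matrix.det_apply]
  exact ContDiffOn.sum fun σ _ => (contDiffOn_prod fun i _ => hG _ _).const_smul _

variable {G : E → Matrix (Fin n) (Fin n) ℝ} (hG : ∀ i j, ContDiffOn ℝ m (fun y => G y i j) s)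
  (hpos : ∀ y ∈ s, (G y).PosDef)

include hG hpos

/-- Cramer's rule: an entry of the inverse is a quotient of determinants with smooth entries and
nonvanishing denominator. -/
theorem contDiffOn_inv_apply (i j : Fin n) : ContDiffOn ℝ m (fun y => (G y)⁻¹ i j) s := by
  simp only [Matrix.inv_def, Matrix.smul_apply, smul_eq_mul, Ring.inverse_eq_inv',
    Matrix.adjugate_apply]
  refine ((contDiffOn_det hG).inv fun y hy => (hpos y hy).det_pos.ne').mul (contDiffOn_det ?_)
  intro k l
  by_cases hk : k = j
  · subst hk
    simp only [Matrix.updateRow_self]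
    exact contDiffOn_const
  · simp only [Matrix.updateRow_ne hk]
    exact hG k l

theorem contDiffOn_sqrt_det : ContDiffOn ℝ m (fun y => √(G y).det) s :=
  (contDiffOn_det hG).sqrt fun y hy => (hpos y hy).det_pos.ne'

theorem contDiffOn_volForm : ContDiffOn ℝ m (fun y => volForm (G y)) s :=
  (contDiffOn_sqrt_det hG hpos).smul contDiffOn_const

theorem contDiffOn_coordInner {w η : E → (Coord n) [⋀^Fin p]→L[ℝ] ℝ} (hw : ContDiffOn ℝ m w s)
    (hη : ContDiffOn ℝ m η s) : ContDiffOn ℝ m (fun y => coordInner (G y) (w y) (η y)) s := by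
  rw [contDiffOn_form_iff] at hw hη
  exact contDiffOn_const.mul (ContDiffOn.sum fun I _ => ContDiffOn.sum fun J _ =>
    ((contDiffOn_prod fun k _ => contDiffOn_inv_apply hG hpos _ _).mul (hw I)).mul (hη J))

theorem contDiffOn_coordStar (h : p + q = n) {w : E → (Coord n) [⋀^Fin p]→L[ℝ] ℝ}
    (hw : ContDiffOn ℝ m w s) : ContDiffOn ℝ m (fun y => coordStar h (G y) (w y)) s := by
  rw [contDiffOn_form_iff] at hw
  refine ContDiffOn.const_smul _ (ContDiffOn.sum fun I _ => ContDiffOn.sum fun J _ =>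
    ((contDiffOn_prod fun k _ => contDiffOn_inv_apply hG hpos _ _).mul (hw I)).smul ?_)
  simp only [volForm, insertLeft_smul]
  exact (contDiffOn_sqrt_det hG hpos).smul contDiffOn_const

end Smoothness

/-! ### The Lie derivative -/

theorem compContinuousLinearMap_id (w : (Coord n) [⋀^Fin p]→L[ℝ] ℝ) :
    w.compContinuousLinearMap (ContinuousLinearMap.id ℝ (Coord n)) = w := rfl

/-- The Lie derivative depends only on the first-order part of the flow, so the affine map $y\mapsto
y+t\xi$, with derivative $1+tD\xi$, replaces it. Identities compatible with pullback can then be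
differentiated at $t=0$. -/
theorem hasDerivAt_coordLie {ξ : Coord n → Coord n} {w : Coord n → (Coord n) [⋀^Fin p]→L[ℝ] ℝ}
    {y : Coord n} (hw : DifferentiableAt ℝ w y) :
    HasDerivAt (fun t : ℝ => (w (y + t • ξ y)).compContinuousLinearMap
      (ContinuousLinearMap.id ℝ (Coord n) + t • fderiv ℝ ξ y)) (coordLie ξ w y) 0 := by
  have h1 : HasDerivAt (fun t : ℝ => y + t • ξ y) (ξ y) 0 := by
    simpa using ((hasDerivAt_id (0 : ℝ)).smul_const (ξ y)).const_add y
  have h2 : HasDerivAt (fun t : ℝ => ContinuousLinearMap.id ℝ (Coord n) + t • fderiv ℝ ξ y)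
      (fderiv ℝ ξ y) 0 := by
    simpa using ((hasDerivAt_id (0 : ℝ)).smul_const (fderiv ℝ ξ y)).const_add
      (ContinuousLinearMap.id ℝ (Coord n))
  have h3 : HasDerivAt (fun t : ℝ => w (y + t • ξ y)) (fderiv ℝ w y (ξ y)) 0 := by
    refine HasFDerivAt.comp_hasDerivAt (0 : ℝ) ?_ h1
    simpa using hw.hasFDerivAt
  have h4 := (h3.hasFDerivAt.continuousAlternatingMapCompContinuousLinearMap
    h2.hasFDerivAt).hasDerivAt
  have h0 : ContinuousLinearMap.id ℝ (Coord n) + (0 : ℝ) • fderiv ℝ ξ y =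
      ContinuousLinearMap.id ℝ (Coord n) := by ext v; simp
  refine h4.congr_deriv ?_
  rw [h0]
  simp [coordLie, compContinuousLinearMap_id]

/-- Pullback commutes with the wedge product, so the Leibniz rule is the product rule for a bilinear
map at $t=0$. -/
theorem coordLie_wedge (h : p + q = r) {ξ : Coord n → Coord n}
    {a : Coord n → (Coord n) [⋀^Fin p]→L[ℝ] ℝ} {b : Coord n → (Coord n) [⋀^Fin q]→L[ℝ] ℝ}
    {y : Coord n} (ha : DifferentiableAt ℝ a y) (hb : DifferentiableAt ℝ b y) :
    coordLie ξ (fun z => wedge h (a z) (b z)) y =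
      wedge h (coordLie ξ a y) (b y) + wedge h (a y) (coordLie ξ b y) := by
  let B := (wedgeₗ (V := Coord n) h).toContinuousBilinearMap
  have hd : DifferentiableAt ℝ (fun z => wedge h (a z) (b z)) y :=
    (B.hasFDerivAt_of_bilinear ha.hasFDerivAt hb.hasFDerivAt).differentiableAt
  have h1 := hasDerivAt_coordLie (ξ := ξ) hd
  simp only [← wedge_compContinuousLinearMap] at h1
  have h2 := (B.hasFDerivAt_of_bilinear (hasDerivAt_coordLie (ξ := ξ) ha).hasFDerivAt
    (hasDerivAt_coordLie (ξ := ξ) hb).hasFDerivAt).hasDerivAt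
  have h0 : ContinuousLinearMap.id ℝ (Coord n) + (0 : ℝ) • fderiv ℝ ξ y =
      ContinuousLinearMap.id ℝ (Coord n) := by ext v; simp
  rw [h1.unique h2, add_comm, h0]
  simp [B, wedgeₗ, compContinuousLinearMap_id]

/-- Cartan's formula in degree zero. -/
theorem coordLie_zero_eq {ξ : Coord n → Coord n} {w : Coord n → (Coord n) [⋀^Fin 0]→L[ℝ] ℝ}
    {y : Coord n} : coordLie ξ w y = interiorProd (ξ y) (extDeriv w y) := by
  ext v
  rw [interiorProd_succ_apply, extDeriv, ContinuousAlternatingMap.alternatizeUncurryFin_apply]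
  simp [coordLie]

/-- Cartan's formula. -/
theorem coordLie_succ_eq {ξ : Coord n → Coord n} {w : Coord n → (Coord n) [⋀^Fin (p + 1)]→L[ℝ] ℝ}
    {y : Coord n} (hξ : DifferentiableAt ℝ ξ y) (hw : DifferentiableAt ℝ w y) :
    coordLie ξ w y = (extDeriv w y).curryLeft (ξ y) +
      extDeriv (fun z => (w z).curryLeft (ξ z)) y := by
  let B : Coord n →L[ℝ] (Coord n) [⋀^Fin (p + 1)]→L[ℝ] ℝ →L[ℝ] (Coord n) [⋀^Fin p]→L[ℝ] ℝ :=
    (interiorProdₗ n (p + 1)).toContinuousBilinearMap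
  have hB : HasFDerivAt (fun z => (w z).curryLeft (ξ z)) _ y :=
    B.hasFDerivAt_of_bilinear hξ.hasFDerivAt hw.hasFDerivAt
  ext v
  rw [ContinuousAlternatingMap.add_apply, ContinuousAlternatingMap.curryLeft_apply_apply, extDeriv,
    extDeriv, hB.fderiv,
    ContinuousAlternatingMap.alternatizeUncurryFin_apply,
    ContinuousAlternatingMap.alternatizeUncurryFin_apply, Fin.sum_univ_succ, coordLie,
    ContinuousAlternatingMap.fderivCompContinuousLinearMap_eq_alternatizeUncurryFin]
  simp [ContinuousAlternatingMap.alternatizeUncurryFin_apply]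
  have hB' : ∀ (a : Coord n) (η : (Coord n) [⋀^Fin (p + 1)]→L[ℝ] ℝ) (u : Fin p → Coord n),
      B a η u = η (Matrix.vecCons a u) := fun _ _ _ => rfl
  have hr : ∀ i : Fin (p + 1), i.succ.removeNth (Matrix.vecCons (ξ y) v) =
      Matrix.vecCons (ξ y) (i.removeNth v) := by
    intro i
    funext k
    cases k using Fin.cases <;> simp [Fin.removeNth, Matrix.vecCons]
  -- The terms differentiating `w` along the `v i` occur in $i_\xi dw$ and in $d\,i_\xi w$ with
  -- opposite signs. What remains is $Dw\,\xi$ and the terms in $D\xi$.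
  simp only [hB', hr, Finset.sum_add_distrib, pow_succ, mul_neg, mul_one, neg_mul,
    Finset.sum_neg_distrib]
  ring

/-- In Cartan's formula $i_\xi dw$ drops out, since $dw$ has degree above the dimension. -/
theorem coordLie_top {m : ℕ} {ξ : Coord (m + 1) → Coord (m + 1)}
    {w : Coord (m + 1) → (Coord (m + 1)) [⋀^Fin (m + 1)]→L[ℝ] ℝ} {y : Coord (m + 1)}
    (hξ : DifferentiableAt ℝ ξ y) (hw : DifferentiableAt ℝ w y) :
    coordLie ξ w y = extDeriv (fun z => (w z).curryLeft (ξ z)) y := by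
  rw [coordLie_succ_eq hξ hw, form_eq_zero_of_lt (Nat.lt_succ_self _) (extDeriv w y)]
  exact zero_add _

/-- Apply the Leibniz rule to $w\wedge*w=|w|^2\,\mathrm{vol}$. Both $Lw\wedge*w$ and $w\wedge*Lw$
equal $\langle Lw,w\rangle\,\mathrm{vol}$, whence the factor 2. -/
theorem wedge_coordBracket (h : p + q = n) {G : Coord n → Matrix (Fin n) (Fin n) ℝ}
    {ξ : Coord n → Coord n} {w : Coord n → (Coord n) [⋀^Fin p]→L[ℝ] ℝ} {s : Set (Coord n)}
    (hs : IsOpen s) (hG : ∀ i j, ContDiffOn ℝ ∞ (fun y => G y i j) s)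
    (hpos : ∀ y ∈ s, (G y).PosDef) (hw : ContDiffOn ℝ ∞ w s) {y : Coord n} (hy : y ∈ s) :
    wedge h (w y) (coordBracket h G ξ w y) =
      coordLie ξ (fun z => coordInner (G z) (w z) (w z) • volForm (G z)) y -
        (2 * coordInner (G y) (coordLie ξ w y) (w y)) • volForm (G y) := by
  have hstar := contDiffOn_coordStar hG hpos h hw
  have hd : ∀ {F : Type} [NormedAddCommGroup F] [NormedSpace ℝ F] {f : Coord n → F},
      ContDiffOn ℝ ∞ f s → DifferentiableAt ℝ f y := fun hf =>
    (hf.contDiffAt (hs.mem_nhds hy)).differentiableAt (by simp)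
  have hL := coordLie_wedge h (ξ := ξ) (hd hw) (hd hstar)
  simp only [wedge_coordStar] at hL
  have hsymm : (G y).transpose = G y := by
    have := (hpos y hy).isHermitian
    rwa [Matrix.IsHermitian, Matrix.conjTranspose_eq_transpose_of_trivial] at this
  have hsub : wedge h (w y) (coordBracket h G ξ w y) =
      wedge h (w y) (coordLie ξ (fun z => coordStar h (G z) (w z)) y) -
        wedge h (w y) (coordStar h (G y) (coordLie ξ w y)) := by
    have := map_sub (wedgeₗ h (w y)) (coordLie ξ (fun z => coordStar h (G z) (w z)) y)
      (coordStar h (G y) (coordLie ξ w y))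
    exact this
  rw [hsub, hL, wedge_coordStar, coordInner_comm hsymm (w y), two_mul, add_smul]
  abel

end Calculus


/-! ### Changes of coordinates and the metric in charts -/

section Charts

variable {n p q : ℕ} {M : Type*} [TopologicalSpace M] [ChartedSpace (Coord n) M]

/-- The change of coordinates from the chart at `c` to the chart at `c'`. -/
def transition (c c' : M) (y : Coord n) : Coord n :=
  extChartAt (𝓡 n) c' ((extChartAt (𝓡 n) c).symm y)

theorem extChartAt_symm_transition {c c' : M} {y : Coord n}
    (hy : (extChartAt (𝓡 n) c).symm y ∈ (extChartAt (𝓡 n) c').source) :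
    (extChartAt (𝓡 n) c').symm (transition c c' y) = (extChartAt (𝓡 n) c).symm y :=
  (extChartAt (𝓡 n) c').left_inv hy

theorem transition_mem_target {c c' : M} {y : Coord n}
    (hy : (extChartAt (𝓡 n) c).symm y ∈ (extChartAt (𝓡 n) c').source) :
    transition c c' y ∈ (extChartAt (𝓡 n) c').target :=
  (extChartAt (𝓡 n) c').map_source hy

theorem eventually_mem_overlap {c c' : M} {y : Coord n} (hy : y ∈ (extChartAt (𝓡 n) c).target)
    (hy' : (extChartAt (𝓡 n) c).symm y ∈ (extChartAt (𝓡 n) c').source) :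
    ∀ᶠ z in nhds y, z ∈ (extChartAt (𝓡 n) c).target ∧
      (extChartAt (𝓡 n) c).symm z ∈ (extChartAt (𝓡 n) c').source := by
  refine Filter.Eventually.and ((isOpen_extChartAt_target c).mem_nhds hy) ?_
  exact (((continuousOn_extChartAt_symm c).continuousAt
    ((isOpen_extChartAt_target c).mem_nhds hy)).preimage_mem_nhds
    ((isOpen_extChartAt_source c').mem_nhds hy'))

variable [IsManifold (𝓡 n) ∞ M]

theorem contDiffAt_transition {c c' : M} {y : Coord n} (hy : y ∈ (extChartAt (𝓡 n) c).target)
    (hy' : (extChartAt (𝓡 n) c).symm y ∈ (extChartAt (𝓡 n) c').source) :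
    ContDiffAt ℝ ∞ (transition c c') y := by
  have h := contDiffWithinAt_ext_coord_change (I := 𝓡 n) (n := ∞) c' c (y := y) (by
    rw [PartialEquiv.trans_source]
    exact ⟨hy, hy'⟩)
  rwa [ModelWithCorners.Boundaryless.range_eq_univ, contDiffWithinAt_univ] at h

theorem mdifferentiableAt_extChartAt_symm {c : M} {y : Coord n}
    (hy : y ∈ (extChartAt (𝓡 n) c).target) :
    MDifferentiableAt 𝓘(ℝ, Coord n) (𝓡 n) (extChartAt (𝓡 n) c).symm y :=
  ((contMDiffOn_extChartAt_symm (n := ∞) c).contMDiffAt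
    ((isOpen_extChartAt_target c).mem_nhds hy)).mdifferentiableAt (by simp)

theorem mdifferentiableAt_extChartAt_of_mem {c x : M} (hx : x ∈ (extChartAt (𝓡 n) c).source) :
    MDifferentiableAt (𝓡 n) 𝓘(ℝ, Coord n) (extChartAt (𝓡 n) c) x :=
  (contMDiffAt_extChartAt' (n := ∞) (by rwa [extChartAt_source] at hx)).mdifferentiableAt (by simp)

theorem fderiv_transition {c c' : M} {y : Coord n} (hy : y ∈ (extChartAt (𝓡 n) c).target)
    (hy' : (extChartAt (𝓡 n) c).symm y ∈ (extChartAt (𝓡 n) c').source) :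
    fderiv ℝ (transition c c') y = (dChart c' ((extChartAt (𝓡 n) c).symm y)).comp (dParam c y) := by
  rw [← mfderiv_eq_fderiv]
  exact mfderiv_comp y (mdifferentiableAt_extChartAt_of_mem hy') (mdifferentiableAt_extChartAt_symm hy)

theorem dChart_comp_dParam {c : M} {y : Coord n} (hy : y ∈ (extChartAt (𝓡 n) c).target) :
    (dChart c ((extChartAt (𝓡 n) c).symm y)).comp (dParam c y) =
      ContinuousLinearMap.id ℝ (Coord n) := by
  rw [← fderiv_transition hy ((extChartAt (𝓡 n) c).map_target hy)]
  have h : transition c c =ᶠ[nhds y] id := by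
    filter_upwards [(isOpen_extChartAt_target c).mem_nhds hy] with z hz
    exact (extChartAt (𝓡 n) c).right_inv hz
  rw [h.fderiv_eq, fderiv_id]

theorem comp_eq_id_comm {A B : Coord n →L[ℝ] Coord n}
    (h : A.comp B = ContinuousLinearMap.id ℝ (Coord n)) :
    B.comp A = ContinuousLinearMap.id ℝ (Coord n) := by
  have h1 : (A : Coord n →ₗ[ℝ] Coord n) * (B : Coord n →ₗ[ℝ] Coord n) = 1 := by
    ext1 v
    exact DFunLike.congr_fun h v
  ext1 v
  exact LinearMap.congr_fun (mul_eq_one_comm.1 h1) v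

/-- Tangent spaces are copies of `Coord n`, and a one-sided inverse of an endomorphism in finite
dimension is two-sided. -/
theorem dParam_comp_dChart {c : M} {y : Coord n} (hy : y ∈ (extChartAt (𝓡 n) c).target) :
    (dParam c y).comp (dChart c ((extChartAt (𝓡 n) c).symm y)) = ContinuousLinearMap.id ℝ _ :=
  comp_eq_id_comm (dChart_comp_dParam hy)

theorem det_fderiv_transition_ne_zero {c c' : M} {y : Coord n}
    (hy : y ∈ (extChartAt (𝓡 n) c).target)
    (hy' : (extChartAt (𝓡 n) c).symm y ∈ (extChartAt (𝓡 n) c').source) :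
    (fderiv ℝ (transition c c') y).det ≠ 0 := by
  have h1 : fderiv ℝ (transition c' c ∘ transition c c') y = ContinuousLinearMap.id ℝ (Coord n) := by
    have h : transition c' c ∘ transition c c' =ᶠ[nhds y] id := by
      filter_upwards [eventually_mem_overlap hy hy'] with z hz
      simp only [Function.comp, transition, id]
      rw [(extChartAt (𝓡 n) c').left_inv hz.2, (extChartAt (𝓡 n) c).right_inv hz.1]
    rw [h.fderiv_eq, fderiv_id]
  have hc : (extChartAt (𝓡 n) c').symm (transition c c' y) ∈ (extChartAt (𝓡 n) c).source := by
    rw [extChartAt_symm_transition hy']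
    exact (extChartAt (𝓡 n) c).map_target hy
  rw [fderiv_comp y ((contDiffAt_transition (transition_mem_target hy') hc).differentiableAt
    (by simp)) ((contDiffAt_transition hy hy').differentiableAt (by simp))] at h1
  intro h0
  have h2 := congrArg (fun L : Coord n →L[ℝ] Coord n => LinearMap.det (L : Coord n →ₗ[ℝ] Coord n)) h1
  have h3 : LinearMap.det ((ContinuousLinearMap.id ℝ (Coord n) : Coord n →L[ℝ] Coord n) :
      Coord n →ₗ[ℝ] Coord n) = 1 := LinearMap.det_id
  have h4 : LinearMap.det ((fderiv ℝ (transition c c') y : Coord n →L[ℝ] Coord n) :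
      Coord n →ₗ[ℝ] Coord n) = 0 := h0
  simp only [ContinuousLinearMap.toLinearMap_comp, LinearMap.det_comp, h3, h4, mul_zero] at h2
  exact zero_ne_one h2

/-- The derivatives of the inverse charts are related by the derivative of the change of
coordinates. -/
theorem dParam_transition {c c' : M} {y : Coord n} (hy : y ∈ (extChartAt (𝓡 n) c).target)
    (hy' : (extChartAt (𝓡 n) c).symm y ∈ (extChartAt (𝓡 n) c').source) {β : Sort*}
    (f : ∀ x : M, (Coord n →L[ℝ] TangentSpace (𝓡 n) x) → β) :
    f _ (dParam c y) = f _ ((dParam c' (transition c c' y)).comp (fderiv ℝ (transition c c') y)) := by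
  rw [fderiv_transition hy hy']
  -- The two base points are equal, but not by definition. With both generalised, substitution
  -- avoids transport between tangent spaces.
  have key : ∀ (x x' : M) (hx : x' = x) (L : Coord n →L[ℝ] TangentSpace (𝓡 n) x)
      (L' : Coord n →L[ℝ] TangentSpace (𝓡 n) x')
      (hL : L'.comp (dChart c' x') = ContinuousLinearMap.id ℝ _),
      f x L = f x' (L'.comp ((dChart c' x).comp L)) := by
    rintro x _ rfl L L' hL
    rw [← ContinuousLinearMap.comp_assoc, hL, ContinuousLinearMap.id_comp]
  exact key _ _ (extChartAt_symm_transition hy') _ _ (dParam_comp_dChart (transition_mem_target hy'))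

theorem formInChart_transition (α : FormField n M p) {c c' : M} {y : Coord n}
    (hy : y ∈ (extChartAt (𝓡 n) c).target)
    (hy' : (extChartAt (𝓡 n) c).symm y ∈ (extChartAt (𝓡 n) c').source) :
    formInChart α c y = (formInChart α c' (transition c c' y)).compContinuousLinearMap
      (fderiv ℝ (transition c c') y) :=
  dParam_transition hy hy' fun x L => (α x).compContinuousLinearMap L

theorem vecInChart_transition (X : VecField n M) {c c' : M} {y : Coord n}
    (hy : y ∈ (extChartAt (𝓡 n) c).target)
    (hy' : (extChartAt (𝓡 n) c).symm y ∈ (extChartAt (𝓡 n) c').source) :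
    vecInChart X c' (transition c c' y) = fderiv ℝ (transition c c') y (vecInChart X c y) := by
  rw [fderiv_transition hy hy']
  have key : ∀ x x' : M, x' = x → dChart c' x' (X x') = dChart c' x (X x) := by
    rintro x _ rfl; rfl
  refine (key _ _ (extChartAt_symm_transition hy')).trans ?_
  have := DFunLike.congr_fun (dParam_comp_dChart hy) (X ((extChartAt (𝓡 n) c).symm y))
  exact congrArg _ this.symm

theorem gram_transition (g : Metric n M) {c c' : M} {y : Coord n}
    (hy : y ∈ (extChartAt (𝓡 n) c).target)
    (hy' : (extChartAt (𝓡 n) c).symm y ∈ (extChartAt (𝓡 n) c').source) :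
    gram g c y = (coordMatrix (fderiv ℝ (transition c c') y)).transpose *
      gram g c' (transition c c' y) * coordMatrix (fderiv ℝ (transition c c') y) := by
  have h := dParam_transition hy hy' fun x L =>
    (Matrix.of fun i j => g.inner x (L (std i)) (L (std j)) : Matrix (Fin n) (Fin n) ℝ)
  refine h.trans ?_
  ext i j
  simp only [Matrix.of_apply, ContinuousLinearMap.comp_apply, map_std_eq_sum _ i,
    map_std_eq_sum _ j, map_sum, map_smul, sum_apply,
    smul_apply, Matrix.mul_apply, Matrix.transpose_apply, smul_eq_mul,
    Finset.mul_sum, Finset.sum_mul]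
  refine Finset.sum_congr rfl fun k _ => Finset.sum_congr rfl fun l _ => ?_
  simp only [gram, Matrix.of_apply]
  ring

theorem sum_mul_gram (g : Metric n M) (c : M) (y u v : Coord n) :
    ∑ i, ∑ j, u i * gram g c y i j * v j = g.inner _ (dParam c y u) (dParam c y v) := by
  conv_rhs => rw [← sum_smul_std u, ← sum_smul_std v]
  simp only [map_sum, map_smul, sum_apply, smul_apply,
    smul_eq_mul, Finset.mul_sum, gram, Matrix.of_apply]
  rw [Finset.sum_comm]
  exact Finset.sum_congr rfl fun k _ => Finset.sum_congr rfl fun l _ => by ring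

/-- Positivity of `g` carries over because `dParam c y` is injective, with left inverse `dChart`. -/
theorem gram_posDef (g : Metric n M) {c : M} {y : Coord n}
    (hy : y ∈ (extChartAt (𝓡 n) c).target) : (gram g c y).PosDef := by
  refine Matrix.PosDef.of_dotProduct_mulVec_pos ?_ fun v hv => ?_
  · ext i j
    exact g.symm _ _ _
  · have h := sum_mul_gram g c y (WithLp.toLp 2 v) (WithLp.toLp 2 v)
    have h1 : star v ⬝ᵥ (gram g c y).mulVec v = ∑ i, ∑ j, v i * gram g c y i j * v j := by
      simp [dotProduct, Matrix.mulVec, Finset.mul_sum, mul_assoc]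
    rw [h1]
    refine lt_of_lt_of_eq (g.pos _ _ fun h0 => hv ?_) h.symm
    have h2 := DFunLike.congr_fun (dChart_comp_dParam hy) (WithLp.toLp 2 v)
    rw [ContinuousLinearMap.comp_apply, h0, map_zero] at h2
    funext i
    exact (congrArg (fun w : Coord n => w i) h2).symm

/-- The coordinate fields are smooth along the inverse chart, being the images of constant fields
under its tangent map; the metric is then evaluated as a smooth section. -/
theorem contDiffOn_gram (g : Metric n M) (c : M) (i j : Fin n) :
    ContDiffOn ℝ ∞ (fun y => gram g c y i j) (extChartAt (𝓡 n) c).target := by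
  have hv : ∀ i : Fin n, ContMDiffOn 𝓘(ℝ, Coord n) ((𝓡 n).prod 𝓘(ℝ, Coord n)) ∞
      (fun y => Bundle.TotalSpace.mk' (Coord n) (E := fun x : M => TangentSpace (𝓡 n) x)
        ((extChartAt (𝓡 n) c).symm y) (dParam c y (std i))) (extChartAt (𝓡 n) c).target := by
    intro i
    have h1 := (contMDiffOn_extChartAt_symm (I := 𝓡 n) (n := ∞) c).contMDiffOn_tangentMapWithin
      (m := ∞) (by simp) (isOpen_extChartAt_target c).uniqueMDiffOn
    have h2 : ContMDiff 𝓘(ℝ, Coord n) (𝓘(ℝ, Coord n).prod 𝓘(ℝ, Coord n)) ∞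
        (fun y => (⟨y, std i⟩ : TangentBundle 𝓘(ℝ, Coord n) (Coord n))) := by
      exact (contMDiff_vectorSpace_iff_contDiff (𝕜 := ℝ) (E := Coord n)
        (V := fun _ => (std i : Coord n))).2 contDiff_const
    refine (h1.comp h2.contMDiffOn fun y hy => hy).congr fun y hy => ?_
    simp only [Function.comp, tangentMapWithin]
    rw [mfderivWithin_of_isOpen (isOpen_extChartAt_target c) hy]
    rfl
  intro y hy
  have := ContMDiffWithinAt.clm_bundle_apply₂ (F₁ := Coord n) (F₂ := Coord n)
    (IB := 𝓡 n) (n := ∞) (E₁ := fun x : M => TangentSpace (𝓡 n) x)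
    (E₂ := fun x : M => TangentSpace (𝓡 n) x) (E₃ := Bundle.Trivial M ℝ) (F₃ := ℝ)
    (g.contMDiff.contMDiffAt.comp_contMDiffWithinAt y (contMDiffOn_extChartAt_symm c y hy))
    (hv i y hy) (hv j y hy)
  rw [Bundle.contMDiffWithinAt_totalSpace] at this
  exact this.2.contDiffWithinAt

end Charts


/-! ### Smooth forms on the manifold: exterior derivative and pointwise inner product -/

section Fields

variable {n p q : ℕ} {M : Type*} [TopologicalSpace M] [ChartedSpace (Coord n) M]

theorem continuous_of_continuousOn_charts {f : M → ℝ}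
    (hf : ∀ c : M, ContinuousOn (fun y => f ((extChartAt (𝓡 n) c).symm y))
      (extChartAt (𝓡 n) c).target) : Continuous f := by
  refine continuous_iff_continuousAt.2 fun x => ?_
  have h1 : ContinuousAt (fun y => f ((extChartAt (𝓡 n) x).symm y)) (extChartAt (𝓡 n) x x) :=
    (hf x).continuousAt ((isOpen_extChartAt_target x).mem_nhds (mem_extChartAt_target x))
  refine (ContinuousAt.comp (f := extChartAt (𝓡 n) x) h1 (continuousAt_extChartAt x)).congr ?_
  filter_upwards [extChartAt_source_mem_nhds (I := 𝓡 n) x] with z hz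
  exact congrArg f ((extChartAt (𝓡 n) x).left_inv hz)

theorem formInChart_add (α β : FormField n M p) (c : M) (y : Coord n) :
    formInChart (fun x => α x + β x) c y = formInChart α c y + formInChart β c y := rfl

theorem IsSmoothForm.add {α β : FormField n M p} (hα : IsSmoothForm α) (hβ : IsSmoothForm β) :
    IsSmoothForm fun x => α x + β x := fun c => (hα c).add (hβ c)

theorem IsSmoothForm.neg {α : FormField n M p} (hα : IsSmoothForm α) :
    IsSmoothForm fun x => -α x := fun c => (hα c).neg

theorem IsSmoothForm.wedge {r : ℕ} (h : p + q = r) {α : FormField n M p} {β : FormField n M q}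
    (hα : IsSmoothForm α) (hβ : IsSmoothForm β) :
    IsSmoothForm fun x => MorseNovikov.wedge h (α x) (β x) := fun c =>
  (contDiffOn_wedge h (hα c) (hβ c)).congr fun _ _ => (wedge_compContinuousLinearMap h _ _ _).symm

variable [IsManifold (𝓡 n) ∞ M]

theorem formInChart_interiorField (X : VecField n M) (α : FormField n M p) {c : M} {y : Coord n}
    (hy : y ∈ (extChartAt (𝓡 n) c).target) :
    formInChart (interiorField X α) c y = interiorProd (vecInChart X c y) (formInChart α c y) := by
  unfold formInChart interiorField
  rw [interiorProd_compContinuousLinearMap]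
  have : dParam c y (vecInChart X c y) = X _ :=
    DFunLike.congr_fun (dParam_comp_dChart hy) (X ((extChartAt (𝓡 n) c).symm y))
  rw [this]

/-- `extDer` uses a different chart at every point. Naturality of the exterior derivative under the
change of coordinates lets a single chart serve throughout its domain, so that smoothness can be
read off. -/
theorem formInChart_extDer {α : FormField n M p} (hα : IsSmoothForm α) {c : M} {y : Coord n}
    (hy : y ∈ (extChartAt (𝓡 n) c).target) :
    formInChart (extDer α) c y = extDeriv (formInChart α c) y := by
  set x := (extChartAt (𝓡 n) c).symm y with hx
  have hy' : (extChartAt (𝓡 n) c).symm y ∈ (extChartAt (𝓡 n) x).source := mem_extChartAt_source x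
  have h1 : formInChart α c =ᶠ[nhds y] fun z =>
      (formInChart α x (transition c x z)).compContinuousLinearMap
        (fderiv ℝ (transition c x) z) := by
    filter_upwards [eventually_mem_overlap hy hy'] with z hz
    exact formInChart_transition α hz.1 hz.2
  rw [h1.extDeriv_eq, extDeriv_pullback (r := ∞) _ (contDiffAt_transition hy hy')
    (by rw [minSmoothness_of_isRCLikeNormedField]; exact WithTop.coe_le_coe.2 le_top),
    fderiv_transition hy hy']
  · rfl
  · exact (((hα x).contDiffAt ((isOpen_extChartAt_target x).mem_nhds
      (transition_mem_target hy'))).differentiableAt (by simp))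

theorem contDiffOn_extDeriv {w : Coord n → (Coord n) [⋀^Fin p]→L[ℝ] ℝ} {s : Set (Coord n)}
    (hs : IsOpen s) (hw : ContDiffOn ℝ ∞ w s) : ContDiffOn ℝ ∞ (extDeriv w) s :=
  (ContinuousAlternatingMap.alternatizeUncurryFinCLM ℝ (Coord n) ℝ).contDiff.comp_contDiffOn
    (hw.fderiv_of_isOpen hs (by simp))

theorem IsSmoothForm.extDer {α : FormField n M p} (hα : IsSmoothForm α) :
    IsSmoothForm (extDer α) := fun c =>
  (contDiffOn_extDeriv (isOpen_extChartAt_target c) (hα c)).congr fun _ hy =>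
    formInChart_extDer hα hy

theorem IsSmoothForm.dTheta {θ : FormField n M 1} (hθ : IsSmoothForm θ) {α : FormField n M p}
    (hα : IsSmoothForm α) : IsSmoothForm (dTheta θ α) :=
  hα.extDer.add (hθ.wedge _ hα)

theorem formInner_extChartAt_symm (g : Metric n M) (α β : FormField n M p) {c : M} {y : Coord n}
    (hy : y ∈ (extChartAt (𝓡 n) c).target) :
    formInner g α β ((extChartAt (𝓡 n) c).symm y) =
      coordInner (gram g c y) (formInChart α c y) (formInChart β c y) := by
  have hy' : (extChartAt (𝓡 n) c).symm y ∈
    (extChartAt (𝓡 n) ((extChartAt (𝓡 n) c).symm y)).source := mem_extChartAt_source _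
  rw [gram_transition g hy hy', formInChart_transition α hy hy', formInChart_transition β hy hy',
    coordInner_compContinuousLinearMap _ _ _ (det_fderiv_transition_ne_zero hy hy')]
  rfl

theorem contDiffOn_formInner (g : Metric n M) {α β : FormField n M p} (hα : IsSmoothForm α)
    (hβ : IsSmoothForm β) (c : M) :
    ContDiffOn ℝ ∞ (fun y => formInner g α β ((extChartAt (𝓡 n) c).symm y))
      (extChartAt (𝓡 n) c).target :=
  (contDiffOn_coordInner (contDiffOn_gram g c) (fun _ hy => gram_posDef g hy) (hα c) (hβ c)).congr
    fun _ hy => formInner_extChartAt_symm g α β hy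

theorem continuous_formInner (g : Metric n M) {α β : FormField n M p} (hα : IsSmoothForm α)
    (hβ : IsSmoothForm β) : Continuous (formInner g α β) :=
  continuous_of_continuousOn_charts fun c => (contDiffOn_formInner g hα hβ c).continuousOn

theorem formInner_comm (g : Metric n M) (α β : FormField n M p) (x : M) :
    formInner g α β x = formInner g β α x := by
  refine coordInner_comm ?_ _ _
  have := (gram_posDef g (mem_extChartAt_target (I := 𝓡 n) x)).isHermitian
  rwa [Matrix.IsHermitian, Matrix.conjTranspose_eq_transpose_of_trivial] at this

theorem formInner_add_left (g : Metric n M) (α β γ : FormField n M p) (x : M) :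
    formInner g (fun x => α x + β x) γ x = formInner g α γ x + formInner g β γ x := by
  unfold formInner
  rw [formInChart_add, coordInner_add_left]

theorem formInner_smul_left (g : Metric n M) (f : M → ℝ) (α β : FormField n M p) (x : M) :
    formInner g (fun x => f x • α x) β x = f x * formInner g α β x := by
  have h : formInChart (fun x => f x • α x) x (extChartAt (𝓡 n) x x) =
      f ((extChartAt (𝓡 n) x).symm (extChartAt (𝓡 n) x x)) •
        formInChart α x (extChartAt (𝓡 n) x x) := rfl
  unfold formInner
  rw [h, coordInner_smul_left, extChartAt_to_inv]

theorem formInner_neg_left (g : Metric n M) (α β : FormField n M p) (x : M) :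
    formInner g (fun x => -α x) β x = -formInner g α β x := by
  have h : (fun x => -α x : FormField n M p) = fun x => (-1 : ℝ) • α x :=
    funext fun x => (neg_one_smul ℝ (α x)).symm
  rw [h, formInner_smul_left g (fun _ => -1), neg_one_mul]

theorem formInner_self_nonneg (g : Metric n M) (α : FormField n M p) (x : M) :
    0 ≤ formInner g α α x :=
  coordInner_self_nonneg (gram_posDef g (mem_extChartAt_target x)) _

theorem eq_zero_of_formInChart_self (α : FormField n M p) (x : M) :
    formInChart α x (extChartAt (𝓡 n) x x) = 0 → α x = 0 := by
  have key : ∀ (z z' : M) (hz : z' = z) (L : Coord n →L[ℝ] TangentSpace (𝓡 n) z')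
      (hL : L.comp (dChart x z') = ContinuousLinearMap.id ℝ _),
      (α z').compContinuousLinearMap L = 0 → α z = 0 := by
    intro z z' hz L hL h
    subst hz
    ext v
    have := DFunLike.congr_fun h (dChart x z' ∘ v)
    rw [ContinuousAlternatingMap.compContinuousLinearMap_apply] at this
    have hv : L ∘ dChart x z' ∘ v = v := by
      funext k
      exact DFunLike.congr_fun hL (v k)
    rw [hv] at this
    exact this
  exact key _ _ (extChartAt_to_inv x) _ (dParam_comp_dChart (mem_extChartAt_target x))

theorem formInner_self_eq_zero (g : Metric n M) {α : FormField n M p} {x : M}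
    (h : formInner g α α x = 0) : α x = 0 :=
  eq_zero_of_formInChart_self α x
    (coordInner_self_eq_zero (gram_posDef g (mem_extChartAt_target x)) h)

/-! ### The vector field dual to a one-form -/

section Dual

variable {g : Metric n M} {θ : FormField n M 1} {X : VecField n M}
  (hX : ∀ x v, g.inner x (X x) v = θ x (fun _ => v))

include hX

/-- Duality reads $\theta_i=X^kg_{ki}$ in coordinates; invert the Gram matrix. -/
theorem vecInChart_dual {c : M} {y : Coord n} (hy : y ∈ (extChartAt (𝓡 n) c).target) (j : Fin n) :
    vecInChart X c y j = ∑ i, (gram g c y)⁻¹ i j * formInChart θ c y (fun _ => std i) := by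
  have hP : dParam c y (vecInChart X c y) = X _ :=
    DFunLike.congr_fun (dParam_comp_dChart hy) (X ((extChartAt (𝓡 n) c).symm y))
  have h1 : ∀ i, formInChart θ c y (fun _ => std i) =
      ∑ k, vecInChart X c y k * gram g c y k i := by
    intro i
    have h2 := sum_mul_gram g c y (vecInChart X c y) (std i)
    rw [hP, hX] at h2
    refine h2.symm.trans ?_
    simp [std_apply]
  have hdet : IsUnit (gram g c y).det := (gram_posDef g hy).det_pos.ne'.isUnit
  simp only [h1, Finset.mul_sum]
  rw [Finset.sum_comm]
  have h3 : ∀ k, ∑ i, (gram g c y)⁻¹ i j * (vecInChart X c y k * gram g c y k i) =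
      vecInChart X c y k * (1 : Matrix (Fin n) (Fin n) ℝ) k j := by
    intro k
    rw [← Matrix.mul_nonsing_inv _ hdet, Matrix.mul_apply, Finset.mul_sum]
    exact Finset.sum_congr rfl fun i _ => by ring
  simp only [h3]
  simp [Matrix.one_apply]

/-- `X` is only given as the dual of `θ`; its smoothness comes from that of `θ` and of the inverse
metric. -/
theorem contDiffOn_vecInChart_dual (hθ : IsSmoothForm θ) (c : M) :
    ContDiffOn ℝ ∞ (vecInChart X c) (extChartAt (𝓡 n) c).target := by
  rw [contDiffOn_euclidean]
  intro j
  refine ContDiffOn.congr ?_ fun y hy => vecInChart_dual hX hy j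
  refine ContDiffOn.sum fun i _ => (contDiffOn_inv_apply (contDiffOn_gram g c)
    (fun _ hy => gram_posDef g hy) i j).mul ?_
  exact contDiffOn_form_iff.1 (hθ c) fun _ => i

theorem isSmoothForm_interiorField (hθ : IsSmoothForm θ) {α : FormField n M p}
    (hα : IsSmoothForm α) : IsSmoothForm (interiorField X α) := fun c =>
  (contDiffOn_interiorProd (contDiffOn_vecInChart_dual hX hθ c) (hα c)).congr fun _ hy =>
    formInChart_interiorField X α hy

theorem formInner_wedge (η : FormField n M p) (α : FormField n M (p + 1)) (x : M) :
    formInner g (fun x => wedge (Nat.add_comm 1 p) (θ x) (η x)) α x =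
      formInner g η (interiorField X α) x := by
  have hy := mem_extChartAt_target (I := 𝓡 n) x
  unfold formInner
  rw [formInChart_interiorField X α hy]
  refine Eq.trans ?_ (coordInner_wedge_one _ (formInChart θ x (extChartAt (𝓡 n) x x)) _ _ _
    (vecInChart_dual hX hy))
  congr 1
  exact (wedge_compContinuousLinearMap _ _ _ _).symm

theorem formInner_wedge_self_zero (α : FormField n M 0) (x : M) :
    formInner g (fun x => wedge (Nat.add_comm 1 0) (θ x) (α x))
      (fun x => wedge (Nat.add_comm 1 0) (θ x) (α x)) x =
      g.inner x (X x) (X x) * formInner g α α x := by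
  rw [formInner_wedge hX, formInner_comm, hX]
  have : interiorField X (fun x => wedge (Nat.add_comm 1 0) (θ x) (α x)) =
      fun x => (θ x fun _ => X x) • α x := funext fun x => interiorProd_wedge_one_zero _ _ _
  rw [this, formInner_smul_left]

/-- By adjointness $|\theta\wedge\alpha|^2=\langle i_X(\theta\wedge\alpha),\alpha\rangle$. The
antiderivation rule gives $|X|^2|\alpha|^2-\langle\theta\wedge i_X\alpha,\alpha\rangle$, and
adjointness again makes the last term $|i_X\alpha|^2$. -/
theorem formInner_wedge_self_succ (α : FormField n M (p + 1)) (x : M) :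
    formInner g (fun x => wedge (Nat.add_comm 1 (p + 1)) (θ x) (α x))
      (fun x => wedge (Nat.add_comm 1 (p + 1)) (θ x) (α x)) x +
      formInner g (interiorField X α) (interiorField X α) x =
      g.inner x (X x) (X x) * formInner g α α x := by
  rw [formInner_wedge hX, formInner_comm, hX]
  have : interiorField X (fun x => wedge (Nat.add_comm 1 (p + 1)) (θ x) (α x)) =
      fun x => (θ x fun _ => X x) • α x +
        -wedge (Nat.add_comm 1 p) (θ x) (interiorField X α x) := by
    funext x
    rw [← sub_eq_add_neg]
    exact interiorProd_wedge_one_succ _ _ _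
  rw [this, formInner_add_left, formInner_smul_left, formInner_neg_left]
  have h := formInner_wedge hX (interiorField X α) α x
  rw [← h]
  exact neg_add_cancel_right _ _

end Dual

end Fields


/-! ### The Riemannian measure -/

section RiemannianMeasure

variable {n p q : ℕ} {M : Type*} [TopologicalSpace M] [ChartedSpace (Coord n) M]

theorem measurableSet_target_inter_preimage [MeasurableSpace M] [BorelSpace M] (c : M) {A : Set M}
    (hA : MeasurableSet A) :
    MeasurableSet ((extChartAt (𝓡 n) c).target ∩ (extChartAt (𝓡 n) c).symm ⁻¹' A) := by
  have h1 : Measurable ((extChartAt (𝓡 n) c).target.domRestrict (extChartAt (𝓡 n) c).symm) :=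
    (continuousOn_iff_continuous_domRestrict.1 (continuousOn_extChartAt_symm c)).measurable
  have h2 := (isOpen_extChartAt_target (I := 𝓡 n) c).measurableSet.subtype_image (h1 hA)
  convert h2 using 1
  ext y
  constructor
  · rintro ⟨hy, hA⟩
    exact ⟨⟨y, hy⟩, hA, rfl⟩
  · rintro ⟨z, hz, rfl⟩
    exact ⟨z.2, hz⟩

variable [IsManifold (𝓡 n) ∞ M]

theorem continuousOn_sqrt_det_gram (g : Metric n M) (c : M) :
    ContinuousOn (fun y => √(gram g c y).det) (extChartAt (𝓡 n) c).target :=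
  (contDiffOn_sqrt_det (contDiffOn_gram g c) fun _ hy => gram_posDef g hy).continuousOn

theorem sqrt_det_gram_transition (g : Metric n M) {c c' : M} {y : Coord n}
    (hy : y ∈ (extChartAt (𝓡 n) c).target)
    (hy' : (extChartAt (𝓡 n) c).symm y ∈ (extChartAt (𝓡 n) c').source) :
    √(gram g c y).det = |(fderiv ℝ (transition c c') y).det| *
      √(gram g c' (transition c c' y)).det := by
  rw [gram_transition g hy hy', sqrt_det_transpose_mul_mul]

theorem sqrt_det_gram_pos (g : Metric n M) {c : M} {y : Coord n}
    (hy : y ∈ (extChartAt (𝓡 n) c).target) : 0 < √(gram g c y).det :=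
  Real.sqrt_pos.2 (gram_posDef g hy).det_pos

variable [MeasurableSpace M] [BorelSpace M]

theorem aemeasurable_extChartAt_symm (g : Metric n M) (c : M) :
    AEMeasurable (extChartAt (𝓡 n) c).symm
      (((volume : Measure (Coord n)).restrict (extChartAt (𝓡 n) c).target).withDensity
        fun y => ENNReal.ofReal √(gram g c y).det) :=
  ((continuousOn_extChartAt_symm c).aemeasurable
    (isOpen_extChartAt_target c).measurableSet).mono_ac (withDensity_absolutelyContinuous _ _)

theorem chartVolume_apply (g : Metric n M) (c : M) {A : Set M} (hA : MeasurableSet A) :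
    chartVolume g c A =
      ∫⁻ y in (extChartAt (𝓡 n) c).target ∩ (extChartAt (𝓡 n) c).symm ⁻¹' A,
        ENNReal.ofReal √(gram g c y).det := by
  rw [chartVolume, Measure.map_apply_of_aemeasurable (aemeasurable_extChartAt_symm g c) hA,
    withDensity_apply', Measure.restrict_restrict' (isOpen_extChartAt_target c).measurableSet,
    Set.inter_comm]

theorem chartVolume_inter_source (g : Metric n M) (c : M) {A : Set M} (hA : MeasurableSet A) :
    chartVolume g c (A ∩ (extChartAt (𝓡 n) c).source) = chartVolume g c A := by
  rw [chartVolume_apply g c hA,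
    chartVolume_apply g c (hA.inter (isOpen_extChartAt_source c).measurableSet)]
  congr 2
  ext y
  simp only [Set.mem_inter_iff, Set.mem_preimage]
  exact ⟨fun h => ⟨h.1, h.2.1⟩, fun h => ⟨h.1, h.2, (extChartAt (𝓡 n) c).map_target h.1⟩⟩

/-- Change of variables: the Jacobian factor $|\det|$ is exactly the ratio of the two densities
$\sqrt{\det g}$. -/
theorem chartVolume_eq_of_subset (g : Metric n M) {c c' : M} {A : Set M} (hA : MeasurableSet A)
    (hc : A ⊆ (extChartAt (𝓡 n) c).source) (hc' : A ⊆ (extChartAt (𝓡 n) c').source) :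
    chartVolume g c A = chartVolume g c' A := by
  rw [chartVolume_apply g c hA, chartVolume_apply g c' hA]
  set S := (extChartAt (𝓡 n) c).target ∩ (extChartAt (𝓡 n) c).symm ⁻¹' A with hS
  have himage : transition c c' '' S =
      (extChartAt (𝓡 n) c').target ∩ (extChartAt (𝓡 n) c').symm ⁻¹' A := by
    ext z
    constructor
    · rintro ⟨y, hy, rfl⟩
      refine ⟨transition_mem_target (hc' hy.2), ?_⟩
      rw [Set.mem_preimage, extChartAt_symm_transition (hc' hy.2)]
      exact hy.2
    · rintro ⟨hz, hzA⟩
      refine ⟨transition c' c z, ⟨transition_mem_target (hc hzA), ?_⟩, ?_⟩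
      · rw [Set.mem_preimage, extChartAt_symm_transition (hc hzA)]
        exact hzA
      · rw [transition, extChartAt_symm_transition (hc hzA)]
        exact (extChartAt (𝓡 n) c').right_inv hz
  have hinj : Set.InjOn (transition c c') S := by
    intro y hy z hz h
    have := congrArg (extChartAt (𝓡 n) c').symm h
    rw [extChartAt_symm_transition (hc' hy.2), extChartAt_symm_transition (hc' hz.2)] at this
    exact (extChartAt (𝓡 n) c).symm.injOn hy.1 hz.1 this
  rw [← himage, lintegral_image_eq_lintegral_abs_det_fderiv_mul volume
    (measurableSet_target_inter_preimage c hA) (fun y hy =>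
      ((contDiffAt_transition hy.1 (hc' hy.2)).differentiableAt
        (by simp)).hasFDerivAt.hasFDerivWithinAt) hinj]
  refine setLIntegral_congr_fun (measurableSet_target_inter_preimage c hA) fun y hy => ?_
  rw [sqrt_det_gram_transition g hy.1 (hc' hy.2), ENNReal.ofReal_mul (abs_nonneg _)]

variable [CompactSpace M]

/-- By compactness finitely many chart domains cover; made disjoint, they glue the chart measures to
a measure `ν` that agrees with every `chartVolume` on its chart domain. So `ν` dominates all of them
and hence their supremum; the other inequality is immediate. -/
theorem riemVolume_apply (g : Metric n M) {c : M} {A : Set M} (hA : MeasurableSet A)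
    (hc : A ⊆ (extChartAt (𝓡 n) c).source) : riemVolume g A = chartVolume g c A := by
  obtain ⟨t, ht⟩ := CompactSpace.elim_nhds_subcover (fun x : M => (extChartAt (𝓡 n) x).source)
    fun x => extChartAt_source_mem_nhds x
  have htne : (t : Set M).Nonempty := by
    have : c ∈ ⋃ x ∈ t, (extChartAt (𝓡 n) x).source := by rw [ht]; trivial
    simp only [Set.mem_iUnion] at this
    obtain ⟨x, hx, -⟩ := this
    exact ⟨x, hx⟩
  -- The finite cover is listed as a sequence, with repetitions, because `disjointed` needs an
  -- ordered index.
  obtain ⟨s, hs⟩ := t.countable_toSet.exists_eq_range htne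
  let D := disjointed fun i => (extChartAt (𝓡 n) (s i)).source
  have hDm : ∀ i, MeasurableSet (D i) := fun i =>
    MeasurableSet.disjointed (fun i => (isOpen_extChartAt_source (s i)).measurableSet) i
  have hDs : ∀ i, D i ⊆ (extChartAt (𝓡 n) (s i)).source := fun i => disjointed_subset _ i
  have hDu : ⋃ i, D i = Set.univ := by
    rw [iUnion_disjointed]
    refine Eq.trans ?_ ht
    have : ∀ x : M, x ∈ t ↔ ∃ i, s i = x := fun x => by
      rw [← Finset.mem_coe, hs, Set.mem_range]
    ext z
    simp [this]
  let ν : Measure M := Measure.sum fun i => (chartVolume g (s i)).restrict (D i)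
  have hν : ∀ (c : M) (A : Set M), MeasurableSet A → A ⊆ (extChartAt (𝓡 n) c).source →
      ν A = chartVolume g c A := by
    intro c A hA hc
    rw [Measure.sum_apply _ hA]
    have h1 : ∀ i, (chartVolume g (s i)).restrict (D i) A = chartVolume g c (A ∩ D i) := by
      intro i
      rw [Measure.restrict_apply hA]
      exact chartVolume_eq_of_subset g (hA.inter (hDm i)) (Set.inter_subset_right.trans (hDs i))
        (Set.inter_subset_left.trans hc)
    simp only [h1]
    rw [← measure_iUnion (fun i j hij => ?_) fun i => hA.inter (hDm i), ← Set.inter_iUnion, hDu,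
      Set.inter_univ]
    exact ((disjoint_disjointed _) hij).mono Set.inter_subset_right Set.inter_subset_right
  refine le_antisymm ?_ (Measure.le_iff.1 (le_iSup (chartVolume g) c) A hA)
  rw [← hν c A hA hc]
  refine Measure.le_iff.1 (iSup_le fun c' => Measure.le_iff.2 fun B hB => ?_) A hA
  rw [← chartVolume_inter_source g c' hB, ← hν c' _
    (hB.inter (isOpen_extChartAt_source c').measurableSet) Set.inter_subset_right]
  exact measure_mono Set.inter_subset_left

theorem riemVolume_restrict_source (g : Metric n M) (c : M) :
    (riemVolume g).restrict (extChartAt (𝓡 n) c).source = chartVolume g c := by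
  ext A hA
  rw [Measure.restrict_apply hA, riemVolume_apply g
    (hA.inter (isOpen_extChartAt_source c).measurableSet) Set.inter_subset_right,
    chartVolume_inter_source g c hA]

/-- The density is bounded near each point, so the measure is locally finite, and the manifold is
compact. -/
instance (g : Metric n M) : IsFiniteMeasure (riemVolume g) := by
  have : IsLocallyFiniteMeasure (riemVolume g) := by
    refine ⟨fun x => ?_⟩
    have hx := mem_extChartAt_target (I := 𝓡 n) x
    have hcont := (continuousOn_sqrt_det_gram g x).continuousAt
      ((isOpen_extChartAt_target x).mem_nhds hx)
    obtain ⟨r, hr, hball⟩ := Metric.eventually_nhds_iff_ball.1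
      ((hcont.eventually_lt_const (lt_add_one _)).and ((isOpen_extChartAt_target x).mem_nhds hx))
    set C := √(gram g x (extChartAt (𝓡 n) x x)).det + 1
    let U := (extChartAt (𝓡 n) x).source ∩ extChartAt (𝓡 n) x ⁻¹'
      Metric.ball (extChartAt (𝓡 n) x x) r
    have hU : IsOpen U := (continuousOn_extChartAt x).isOpen_inter_preimage
      (isOpen_extChartAt_source x) Metric.isOpen_ball
    refine ⟨U, hU.mem_nhds ⟨mem_extChartAt_source x, Metric.mem_ball_self hr⟩, ?_⟩
    rw [riemVolume_apply g (c := x) hU.measurableSet Set.inter_subset_left,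
      chartVolume_apply g x hU.measurableSet]
    have hsub : (extChartAt (𝓡 n) x).target ∩ (extChartAt (𝓡 n) x).symm ⁻¹' U ⊆
        Metric.ball (extChartAt (𝓡 n) x x) r := by
      rintro y ⟨hy, hyU⟩
      have := hyU.2
      rwa [Set.mem_preimage, (extChartAt (𝓡 n) x).right_inv hy] at this
    calc _ ≤ ∫⁻ y in Metric.ball (extChartAt (𝓡 n) x x) r,
          ENNReal.ofReal √(gram g x y).det := lintegral_mono_set hsub
      _ ≤ ∫⁻ y in Metric.ball (extChartAt (𝓡 n) x x) r, ENNReal.ofReal C :=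
          setLIntegral_mono' measurableSet_ball fun y hy =>
            ENNReal.ofReal_le_ofReal (hball y hy).1.le
      _ < ⊤ := by
          rw [setLIntegral_const]
          exact ENNReal.mul_lt_top ENNReal.ofReal_lt_top measure_ball_lt_top
  infer_instance

/-- The density is strictly positive. This is what turns a vanishing $L^2$ norm of a smooth form
into pointwise vanishing. -/
instance (g : Metric n M) : (riemVolume g).IsOpenPosMeasure := by
  refine ⟨fun U hU ⟨x, hx⟩ h0 => ?_⟩
  have hm := hU.inter (isOpen_extChartAt_source (I := 𝓡 n) x)
  have h1 := measure_mono_null Set.inter_subset_left (t := U)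
    (s := U ∩ (extChartAt (𝓡 n) x).source) h0
  rw [riemVolume_apply g (c := x) hm.measurableSet Set.inter_subset_right,
    chartVolume_inter_source g x hU.measurableSet, chartVolume_apply g x hU.measurableSet] at h1
  have hS : IsOpen ((extChartAt (𝓡 n) x).target ∩ (extChartAt (𝓡 n) x).symm ⁻¹' U) :=
    (continuousOn_extChartAt_symm x).isOpen_inter_preimage (isOpen_extChartAt_target x) hU
  have hmeas := ((continuousOn_sqrt_det_gram g x).mono
    Set.inter_subset_left).aemeasurable (μ := volume) hS.measurableSet
  rw [lintegral_eq_zero_iff' hmeas.ennreal_ofReal, Filter.EventuallyEq,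
    ae_restrict_iff' hS.measurableSet] at h1
  have hS0 : volume ((extChartAt (𝓡 n) x).target ∩ (extChartAt (𝓡 n) x).symm ⁻¹' U) = 0 := by
    refine measure_mono_null (fun y hy => ?_) h1
    intro h
    have := h hy
    simp only [Pi.zero_apply, ENNReal.ofReal_eq_zero] at this
    exact absurd (sqrt_det_gram_pos g hy.1) (not_lt.2 this)
  refine (hS.measure_pos volume ⟨extChartAt (𝓡 n) x x, mem_extChartAt_target x, ?_⟩).ne' hS0
  rw [Set.mem_preimage, extChartAt_to_inv]
  exact hx

theorem integrable_of_continuous (g : Metric n M) {f : M → ℝ} (hf : Continuous f) :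
    Integrable f (riemVolume g) := by
  obtain ⟨C, hC⟩ := isCompact_univ.exists_bound_of_continuousOn hf.continuousOn
  exact Integrable.of_bound hf.aestronglyMeasurable C (Filter.Eventually.of_forall fun x =>
    hC x trivial)

theorem setIntegral_source (g : Metric n M) (c : M) {f : M → ℝ} (hf : Continuous f) :
    ∫ x in (extChartAt (𝓡 n) c).source, f x ∂(riemVolume g) =
      ∫ y in (extChartAt (𝓡 n) c).target,
        √(gram g c y).det * f ((extChartAt (𝓡 n) c).symm y) := by
  rw [riemVolume_restrict_source, chartVolume, integral_map (aemeasurable_extChartAt_symm g c)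
    hf.aestronglyMeasurable, integral_withDensity_eq_integral_toReal_smul₀]
  · refine integral_congr_ae (Filter.Eventually.of_forall fun y => ?_)
    simp [ENNReal.toReal_ofReal (Real.sqrt_nonneg _)]
  · exact ((continuousOn_sqrt_det_gram g c).aemeasurable
      (isOpen_extChartAt_target c).measurableSet).ennreal_ofReal
  · exact Filter.Eventually.of_forall fun y => ENNReal.ofReal_lt_top

end RiemannianMeasure


/-! ### The divergence theorem -/

section Divergence

variable {n m p q : ℕ}

/-- Evaluation of forms as a linear map. -/
def evalₗ (v : Fin p → Coord n) : (Coord n) [⋀^Fin p]→L[ℝ] ℝ →ₗ[ℝ] ℝ where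
  toFun w := w v
  map_add' _ _ := rfl
  map_smul' _ _ := rfl

/-- The top component of $dW$ is a signed sum of directional derivatives of compactly supported
functions, each of integral zero by integration by parts against the constant 1. -/
theorem integral_extDeriv_eq_zero {W : Coord (m + 1) → (Coord (m + 1)) [⋀^Fin m]→L[ℝ] ℝ}
    (hW : ContDiff ℝ ∞ W) (hc : HasCompactSupport W) :
    ∫ y, extDeriv W y std = 0 := by
  have hd : Differentiable ℝ W := hW.differentiable (by simp)
  have hW' : ∀ v : Fin m → Coord (m + 1), ContDiff ℝ ∞ fun y => W y v := fun v =>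
    (LinearMap.toContinuousLinearMap (evalₗ v)).contDiff.comp hW
  have hc' : ∀ v : Fin m → Coord (m + 1), HasCompactSupport fun y => W y v := fun v =>
    hc.comp_left (g := fun w : (Coord (m + 1)) [⋀^Fin m]→L[ℝ] ℝ => w v) rfl
  have hint : ∀ (v : Fin m → Coord (m + 1)) (e : Coord (m + 1)),
      Integrable (fun y => fderiv ℝ (fun z => W z v) y e) := fun v e =>
    (((hW' v).continuous_fderiv (by simp)).clm_apply continuous_const).integrable_of_hasCompactSupport
      ((hc' v).fderiv_apply ℝ e)
  have hzero : ∀ (v : Fin m → Coord (m + 1)) (e : Coord (m + 1)),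
      ∫ y, fderiv ℝ (fun z => W z v) y e = 0 := by
    intro v e
    have := integral_mul_fderiv_eq_neg_fderiv_mul_of_integrable (μ := volume) (𝕜 := ℝ)
      (f := fun _ : Coord (m + 1) => (1 : ℝ)) (g := fun z => W z v) (v := e) (by simp)
      (by simpa using hint v e)
      (by simpa using (hW' v).continuous.integrable_of_hasCompactSupport (hc' v))
      (fun _ _ => differentiableAt_const _) (fun _ _ => (hW' v).differentiable (by simp) _)
    simpa using this
  simp only [extDeriv_apply (hd _), zsmul_eq_mul]
  rw [integral_finsetSum _ fun i _ => (hint _ _).const_mul _]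
  refine Finset.sum_eq_zero fun i _ => ?_
  rw [integral_const_mul, hzero, mul_zero]

variable {M : Type*} [TopologicalSpace M] [ChartedSpace (Coord n) M]

/-- A function on `M` is smooth if its expressions in the charts are. -/
def IsSmoothFun (u : M → ℝ) : Prop :=
  ∀ c : M, ContDiffOn ℝ ∞ (fun y => u ((extChartAt (𝓡 n) c).symm y)) (extChartAt (𝓡 n) c).target

variable {M : Type*} [TopologicalSpace M] [ChartedSpace (Coord (m + 1)) M]
  [IsManifold (𝓡 (m + 1)) ∞ M]

/-- The form `i_X (u dV)` in the chart at `c`. -/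
def fluxForm (g : Metric (m + 1) M) (X : VecField (m + 1) M) (u : M → ℝ) (c : M)
    (y : Coord (m + 1)) : (Coord (m + 1)) [⋀^Fin m]→L[ℝ] ℝ :=
  (u ((extChartAt (𝓡 (m + 1)) c).symm y) • volForm (gram g c y)).curryLeft (vecInChart X c y)

/-- The divergence of `u X`, computed at `x` in the chart at `x`. -/
def divergence (g : Metric (m + 1) M) (X : VecField (m + 1) M) (u : M → ℝ) (x : M) : ℝ :=
  coordDensity (gram g x (extChartAt (𝓡 (m + 1)) x x))
    (extDeriv (fluxForm g X u x) (extChartAt (𝓡 (m + 1)) x x))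

variable {g : Metric (m + 1) M} {X : VecField (m + 1) M}
  (hX : ∀ c, ContDiffOn ℝ ∞ (vecInChart X c) (extChartAt (𝓡 (m + 1)) c).target)
  {u : M → ℝ} (hu : IsSmoothFun (n := m + 1) u)

include hX hu

theorem contDiffOn_fluxForm (c : M) :
    ContDiffOn ℝ ∞ (fluxForm g X u c) (extChartAt (𝓡 (m + 1)) c).target :=
  contDiffOn_interiorProd (hX c) ((hu c).smul
    (contDiffOn_volForm (contDiffOn_gram g c) fun _ hy => gram_posDef g hy))

theorem differentiableAt_fluxForm {c : M} {y : Coord (m + 1)}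
    (hy : y ∈ (extChartAt (𝓡 (m + 1)) c).target) : DifferentiableAt ℝ (fluxForm g X u c) y :=
  ((contDiffOn_fluxForm hX hu c).contDiffAt
    ((isOpen_extChartAt_target c).mem_nhds hy)).differentiableAt (by simp)

/-- The volume forms of two charts correspond under pullback up to the sign of the Jacobian
determinant, and so do the flux forms. The sign appears in the exterior derivative and in the ratio
of volume forms, so the density does not depend on the chart or its orientation. -/
theorem divergence_extChartAt_symm {c : M} {y : Coord (m + 1)}
    (hy : y ∈ (extChartAt (𝓡 (m + 1)) c).target) :
    divergence g X u ((extChartAt (𝓡 (m + 1)) c).symm y) =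
      coordDensity (gram g c y) (extDeriv (fluxForm g X u c) y) := by
  set x := (extChartAt (𝓡 (m + 1)) c).symm y with hx
  have hy' : (extChartAt (𝓡 (m + 1)) c).symm y ∈ (extChartAt (𝓡 (m + 1)) x).source :=
    mem_extChartAt_source x
  set d := (fderiv ℝ (transition c x) y).det with hd
  have hd0 : d ≠ 0 := det_fderiv_transition_ne_zero hy hy'
  have hdet : ContinuousAt (fun z => (fderiv ℝ (transition c x) z).det) y :=
    ContinuousLinearMap.continuous_det.continuousAt.comp
      (((contDiffAt_transition hy hy').fderiv_right (m := 0) (by simp)).continuousAt)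
  -- The sign is constant near `y`, so it passes through the exterior derivative as a scalar.
  have hsign : ∀ᶠ z in nhds y, |(fderiv ℝ (transition c x) z).det| =
      (SignType.sign d : ℝ) * (fderiv ℝ (transition c x) z).det := by
    rcases lt_or_gt_of_ne hd0 with h | h
    · filter_upwards [hdet.eventually_lt_const h] with z hz
      rw [abs_of_neg hz, sign_neg h]
      simp
    · filter_upwards [hdet.eventually_const_lt h] with z hz
      rw [abs_of_pos hz, sign_pos h]
      simp
  have hflux : fluxForm g X u c =ᶠ[nhds y] fun z => (SignType.sign d : ℝ) •
      (fluxForm g X u x (transition c x z)).compContinuousLinearMap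
        (fderiv ℝ (transition c x) z) := by
    filter_upwards [eventually_mem_overlap hy hy', hsign] with z hz hsz
    unfold fluxForm
    rw [vecInChart_transition X hz.1 hz.2, extChartAt_symm_transition hz.2,
      ← ContinuousAlternatingMap.curryLeft_compContinuousLinearMap, top_form_comp]
    have hvol : volForm (gram g c z) = ((SignType.sign d : ℝ) * (fderiv ℝ (transition c x) z).det) •
        volForm (gram g x (transition c x z)) := by
      rw [volForm, volForm, sqrt_det_gram_transition g hz.1 hz.2, hsz, smul_smul]
    rw [hvol]
    ext v
    simp only [ContinuousAlternatingMap.curryLeft_apply_apply, ContinuousAlternatingMap.smul_apply,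
      smul_eq_mul]
    ring
  have hdabs : |d| = (SignType.sign d : ℝ) * d := hsign.self_of_nhds
  have hsmul : ∀ (a : ℝ) (f : Coord (m + 1) → (Coord (m + 1)) [⋀^Fin m]→L[ℝ] ℝ),
      extDeriv (fun z => a • f z) y = a • extDeriv f y := fun a f => extDeriv_smul a f
  rw [hflux.extDeriv_eq, hsmul, extDeriv_pullback (r := ∞)
    (differentiableAt_fluxForm hX hu (transition_mem_target hy')) (contDiffAt_transition hy hy')
    (by rw [minSmoothness_of_isRCLikeNormedField]; exact WithTop.coe_le_coe.2 le_top),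
    top_form_comp, ← hd]
  unfold divergence coordDensity
  rw [sqrt_det_gram_transition g hy hy', ← hd, hdabs]
  have hs : (SignType.sign d : ℝ) ≠ 0 := by
    rcases lt_or_gt_of_ne hd0 with h | h
    · rw [sign_neg h]; simp
    · rw [sign_pos h]; simp
  have hq := (sqrt_det_gram_pos g (transition_mem_target hy')).ne'
  simp only [ContinuousAlternatingMap.smul_apply, smul_eq_mul]
  rw [← mul_assoc, mul_div_mul_left _ _ (mul_ne_zero hs hd0)]
  rfl

theorem continuous_divergence : Continuous (divergence g X u) := by
  refine continuous_of_continuousOn_charts (n := m + 1) fun c => ?_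
  refine ContinuousOn.congr ?_ fun y hy => divergence_extChartAt_symm hX hu hy
  have h1 := contDiffOn_extDeriv (isOpen_extChartAt_target c) (contDiffOn_fluxForm (g := g) hX hu c)
  have h2 := (contDiffOn_form_iff.1 h1 id).continuousOn
  exact h2.div (continuousOn_sqrt_det_gram g c) fun y hy => (sqrt_det_gram_pos g hy).ne'

omit hX hu in
theorem divergence_eq_zero_of_notMem {x : M} (hx : x ∉ tsupport u) : divergence g X u x = 0 := by
  have h1 : ∀ᶠ z in nhds x, u z = 0 := by
    rw [notMem_tsupport_iff_eventuallyEq] at hx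
    exact hx
  have h2 : ContinuousAt (extChartAt (𝓡 (m + 1)) x).symm (extChartAt (𝓡 (m + 1)) x x) :=
    continuousAt_extChartAt_symm x
  have h3 : fluxForm g X u x =ᶠ[nhds (extChartAt (𝓡 (m + 1)) x x)] fun _ => 0 := by
    have h4 : ∀ᶠ z in nhds ((extChartAt (𝓡 (m + 1)) x).symm (extChartAt (𝓡 (m + 1)) x x)),
        u z = 0 := by rwa [extChartAt_to_inv]
    filter_upwards [h2.eventually h4] with y hy
    rw [fluxForm, hy, zero_smul]
    rfl
  rw [divergence, h3.extDeriv_eq]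
  have : extDeriv (fun _ : Coord (m + 1) => (0 : (Coord (m + 1)) [⋀^Fin m]→L[ℝ] ℝ)) = 0 := by
    funext y
    ext v
    simp [extDeriv, ContinuousAlternatingMap.alternatizeUncurryFin_apply]
  rw [this]
  simp [coordDensity]

variable [CompactSpace M] [MeasurableSpace M] [BorelSpace M]

theorem integral_divergence_eq_zero_of_tsupport_subset {c : M}
    (hc : tsupport u ⊆ (extChartAt (𝓡 (m + 1)) c).source) :
    ∫ x, divergence g X u x ∂(riemVolume g) = 0 := by
  have hT := (isOpen_extChartAt_target (I := 𝓡 (m + 1)) c)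
  set K := extChartAt (𝓡 (m + 1)) c '' tsupport u with hK
  have hKc : IsCompact K := (isClosed_tsupport u).isCompact.image_of_continuousOn
    ((continuousOn_extChartAt c).mono hc)
  have hKT : K ⊆ (extChartAt (𝓡 (m + 1)) c).target := by
    rintro _ ⟨x, hx, rfl⟩
    exact (extChartAt (𝓡 (m + 1)) c).map_source (hc hx)
  classical
  -- Extension by zero is smooth: the flux form vanishes off the compact set `K`, and a point
  -- outside the target has a neighbourhood missing `K`.
  let W := (extChartAt (𝓡 (m + 1)) c).target.indicator (fluxForm g X u c)
  have hWK : ∀ y, y ∉ K → W y = 0 := by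
    intro y hy
    by_cases hyT : y ∈ (extChartAt (𝓡 (m + 1)) c).target
    · have : (extChartAt (𝓡 (m + 1)) c).symm y ∉ tsupport u := fun h =>
        hy ⟨_, h, (extChartAt (𝓡 (m + 1)) c).right_inv hyT⟩
      refine (Set.indicator_of_mem hyT _).trans ?_
      rw [fluxForm, image_eq_zero_of_notMem_tsupport this, zero_smul]
      rfl
    · exact Set.indicator_of_notMem hyT _
  have hWT : ∀ y ∈ (extChartAt (𝓡 (m + 1)) c).target, W =ᶠ[nhds y] fluxForm g X u c := by
    intro y hy
    filter_upwards [hT.mem_nhds hy] with z hz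
    exact Set.indicator_of_mem hz _
  have hWs : ContDiff ℝ ∞ W := by
    refine contDiff_iff_contDiffAt.2 fun y => ?_
    by_cases hyT : y ∈ (extChartAt (𝓡 (m + 1)) c).target
    · exact ((contDiffOn_fluxForm hX hu c).contDiffAt (hT.mem_nhds hyT)).congr_of_eventuallyEq
        (hWT y hyT)
    · have : W =ᶠ[nhds y] fun _ => 0 := by
        filter_upwards [hKc.isClosed.isOpen_compl.mem_nhds fun h => hyT (hKT h)] with z hz
        exact hWK z hz
      exact contDiffAt_const.congr_of_eventuallyEq this
  have hWc : HasCompactSupport W := HasCompactSupport.intro hKc hWK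
  rw [← setIntegral_eq_integral_of_forall_compl_eq_zero (s := (extChartAt (𝓡 (m + 1)) c).source)
    fun x hx => divergence_eq_zero_of_notMem fun h => hx (hc h),
    setIntegral_source g c (continuous_divergence hX hu)]
  refine Eq.trans ?_ (integral_extDeriv_eq_zero hWs hWc)
  rw [← setIntegral_eq_integral_of_forall_compl_eq_zero (s := (extChartAt (𝓡 (m + 1)) c).target)
    (f := fun y => extDeriv W y std)]
  · refine setIntegral_congr_fun hT.measurableSet fun y hy => ?_
    rw [divergence_extChartAt_symm hX hu hy, (hWT y hy).extDeriv_eq, coordDensity,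
      mul_div_cancel₀ _ (sqrt_det_gram_pos g hy).ne']
  · intro y hy
    have : W =ᶠ[nhds y] fun _ => 0 := by
      filter_upwards [hKc.isClosed.isOpen_compl.mem_nhds fun h => hy (hKT h)] with z hz
      exact hWK z hz
    rw [this.extDeriv_eq]
    simp [extDeriv, ContinuousAlternatingMap.alternatizeUncurryFin_apply]

/-- The divergence is additive in `u`, so a partition of unity subordinate to charts reduces to
functions supported in one chart. -/
theorem integral_divergence_eq_zero [T2Space M] : ∫ x, divergence g X u x ∂(riemVolume g) = 0 := by
  obtain ⟨t, ht⟩ := CompactSpace.elim_nhds_subcover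
    (fun x : M => (extChartAt (𝓡 (m + 1)) x).source) fun x => extChartAt_source_mem_nhds x
  obtain ⟨ρ, hρ⟩ := SmoothPartitionOfUnity.exists_isSubordinate (𝓡 (m + 1)) (s := Set.univ)
    isClosed_univ (fun i : t => (extChartAt (𝓡 (m + 1)) (i : M)).source)
    (fun i => isOpen_extChartAt_source _) (by
      intro x _
      have : x ∈ ⋃ z ∈ t, (extChartAt (𝓡 (m + 1)) z).source := by rw [ht]; trivial
      simp only [Set.mem_iUnion] at this ⊢
      obtain ⟨z, hz, hxz⟩ := this
      exact ⟨⟨z, hz⟩, hxz⟩)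
  have hsm : ∀ i, IsSmoothFun (n := m + 1) fun x => ρ i x * u x := by
    intro i c
    refine ContDiffOn.mul ?_ (hu c)
    exact ((ρ i).contMDiff.comp_contMDiffOn (contMDiffOn_extChartAt_symm c)).contDiffOn
  have hsum : ∀ x, divergence g X u x = ∑ i, divergence g X (fun x => ρ i x * u x) x := by
    intro x
    have h1 : fluxForm g X u x = fun y => ∑ i, fluxForm g X (fun x => ρ i x * u x) x y := by
      funext y
      have h2 : ∑ i, ρ i ((extChartAt (𝓡 (m + 1)) x).symm y) = 1 := by
        rw [← finsum_eq_sum_of_fintype]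
        exact ρ.sum_eq_one trivial
      ext v
      simp only [fluxForm, ContinuousAlternatingMap.curryLeft_apply_apply,
        ContinuousAlternatingMap.sum_apply, ContinuousAlternatingMap.smul_apply, smul_eq_mul,
        ← Finset.sum_mul, h2, one_mul]
    have h3 : extDeriv (fluxForm g X u x) (extChartAt (𝓡 (m + 1)) x x) =
        ∑ i, extDeriv (fluxForm g X (fun x => ρ i x * u x) x) (extChartAt (𝓡 (m + 1)) x x) := by
      rw [h1, extDeriv, fderiv_fun_sum fun i _ =>
        differentiableAt_fluxForm hX (hsm i) (mem_extChartAt_target x)]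
      exact map_sum (ContinuousAlternatingMap.alternatizeUncurryFinCLM ℝ (Coord (m + 1)) ℝ) _ _
    simp only [divergence, h3, coordDensity, ContinuousAlternatingMap.sum_apply, Finset.sum_div]
  simp only [hsum]
  rw [integral_finsetSum _ fun i _ =>
    integrable_of_continuous g (continuous_divergence hX (hsm i))]
  refine Finset.sum_eq_zero fun i _ =>
    integral_divergence_eq_zero_of_tsupport_subset hX (hsm i) (c := i) ?_
  exact (closure_mono (Function.support_mul_subset_left _ _)).trans (hρ i)

end Divergence


/-! ### The Lie derivative along `X` and the integral of the commutator term -/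

section Bracket

variable {n p q : ℕ}

/-- Serves dimension zero, where `divergence`, which needs dimension `m + 1`, is not available. -/
theorem coordLie_of_subsingleton [Subsingleton (Coord n)] (ξ : Coord n → Coord n)
    (w : Coord n → (Coord n) [⋀^Fin p]→L[ℝ] ℝ) (y : Coord n) : coordLie ξ w y = 0 := by
  have h1 : ξ y = 0 := Subsingleton.elim _ _
  have h2 : fderiv ℝ ξ y = 0 := Subsingleton.elim _ _
  rw [coordLie, h1, h2]
  ext v
  simp

variable {M : Type*} [TopologicalSpace M] [ChartedSpace (Coord n) M] [IsManifold (𝓡 n) ∞ M]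

/-- `Λ = L_X α`. -/
def IsLieDerivative (X : VecField n M) (α Λ : FormField n M p) : Prop :=
  ∀ x, formInChart Λ x (extChartAt (𝓡 n) x x) =
    coordLie (vecInChart X x) (formInChart α x) (extChartAt (𝓡 n) x x)

theorem isLieDerivative_zero (X : VecField n M) {α : FormField n M 0} (hα : IsSmoothForm α) :
    IsLieDerivative X α (interiorField X (extDer α)) := fun x => by
  have hy := mem_extChartAt_target (I := 𝓡 n) x
  rw [coordLie_zero_eq, ← formInChart_extDer hα hy]
  exact formInChart_interiorField X (extDer α) hy

/-- Cartan's formula for fields. The contractions enter as variables `σ` and `τ` so that their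
degrees read `p` and `p + 1` instead of truncated differences. -/
theorem isLieDerivative_succ {X : VecField n M}
    (hX : ∀ c, ContDiffOn ℝ ∞ (vecInChart X c) (extChartAt (𝓡 n) c).target)
    {α : FormField n M (p + 1)} (hα : IsSmoothForm α) {σ : FormField n M p}
    (hσ : σ = interiorField X α) (hσs : IsSmoothForm σ) {τ : FormField n M (p + 1)}
    (hτ : τ = interiorField X (extDer α)) : IsLieDerivative X α fun x => τ x + extDer σ x :=
  fun x => by
    have hy := mem_extChartAt_target (I := 𝓡 n) x
    have hT := (isOpen_extChartAt_target (I := 𝓡 n) x).mem_nhds hy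
    rw [coordLie_succ_eq (((hX x).contDiffAt hT).differentiableAt (by simp))
      (((hα x).contDiffAt hT).differentiableAt (by simp)), ← formInChart_extDer hα hy]
    have h1 : (fun z => (formInChart α x z).curryLeft (vecInChart X x z))
        =ᶠ[nhds (extChartAt (𝓡 n) x x)] formInChart σ x := by
      filter_upwards [hT] with z hz
      rw [hσ]
      exact (formInChart_interiorField X α hz).symm
    rw [h1.extDeriv_eq, formInChart_add, formInChart_extDer hσs hy, hτ]
    exact congrArg (· + _) (formInChart_interiorField X (extDer α) hy)

theorem coordDensity_smul_volForm {G : Matrix (Fin n) (Fin n) ℝ} (hG : √G.det ≠ 0) (c : ℝ) :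
    coordDensity G (c • volForm G) = c := by
  simp [coordDensity, volForm, coordVol_std, hG]

/-- In `wedge_coordBracket`, the Lie derivative of the top form $|\alpha|^2dV$ is
$d\,i_X(|\alpha|^2dV)$, the divergence of $|\alpha|^2X$ times $dV$. -/
theorem wedgeBracketDensity_eq {m : ℕ} {M : Type*} [TopologicalSpace M]
    [ChartedSpace (Coord (m + 1)) M] [IsManifold (𝓡 (m + 1)) ∞ M] (g : Metric (m + 1) M)
    {X : VecField (m + 1) M}
    (hX : ∀ c, ContDiffOn ℝ ∞ (vecInChart X c) (extChartAt (𝓡 (m + 1)) c).target)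
    (h : p + q = m + 1) {α Λ : FormField (m + 1) M p} (hα : IsSmoothForm α)
    (hΛ : IsLieDerivative X α Λ) (x : M) :
    wedgeBracketDensity g X h α x =
      divergence g X (formInner g α α) x - 2 * formInner g Λ α x := by
  have hy := mem_extChartAt_target (I := 𝓡 (m + 1)) x
  have hO := isOpen_extChartAt_target (I := 𝓡 (m + 1)) x
  have hT := hO.mem_nhds hy
  have hq := (sqrt_det_gram_pos g hy).ne'
  have hpos : ∀ y ∈ (extChartAt (𝓡 (m + 1)) x).target, (gram g x y).PosDef :=
    fun _ hy => gram_posDef g hy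
  have hu : ContDiffOn ℝ ∞ (fun z => coordInner (gram g x z) (formInChart α x z)
      (formInChart α x z) • volForm (gram g x z)) (extChartAt (𝓡 (m + 1)) x).target :=
    (contDiffOn_coordInner (contDiffOn_gram g x) hpos (hα x) (hα x)).smul
      (contDiffOn_volForm (contDiffOn_gram g x) hpos)
  unfold wedgeBracketDensity
  rw [wedge_coordBracket h hO (contDiffOn_gram g x) hpos (hα x) hy,
    coordLie_top (((hX x).contDiffAt hT).differentiableAt (by simp))
      ((hu.contDiffAt hT).differentiableAt (by simp)), ← hΛ x]
  have h1 : (fun z => (coordInner (gram g x z) (formInChart α x z) (formInChart α x z) •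
      volForm (gram g x z)).curryLeft (vecInChart X x z))
      =ᶠ[nhds (extChartAt (𝓡 (m + 1)) x x)] fluxForm g X (formInner g α α) x := by
    filter_upwards [hT] with z hz
    rw [fluxForm, formInner_extChartAt_symm g α α hz]
  rw [h1.extDeriv_eq]
  refine Eq.trans ?_ (congrArg (divergence g X (formInner g α α) x - ·)
    (coordDensity_smul_volForm hq _))
  simp only [coordDensity, divergence, ContinuousAlternatingMap.sub_apply, sub_div]
  rfl

theorem wedgeBracketDensity_of_subsingleton [Subsingleton (Coord n)] (g : Metric n M)
    (X : VecField n M) (h : p + q = n) (α : FormField n M p) (x : M) : wedgeBracketDensity g X h α x = 0 := by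
  have h0 : coordStar h (gram g x (extChartAt (𝓡 n) x x)) (0 : (Coord n) [⋀^Fin p]→L[ℝ] ℝ) = 0 := by
    simp [coordStar]
  unfold wedgeBracketDensity coordBracket
  rw [coordLie_of_subsingleton, coordLie_of_subsingleton, h0, sub_zero]
  have := map_zero (wedgeₗ h (formInChart α x (extChartAt (𝓡 n) x x)))
  rw [show wedge h (formInChart α x (extChartAt (𝓡 n) x x)) 0 = 0 from this]
  simp [coordDensity]

variable [MeasurableSpace M] [BorelSpace M] [CompactSpace M] [T2Space M]

theorem integral_wedgeBracketDensity (g : Metric n M) {X : VecField n M}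
    (hX : ∀ c, ContDiffOn ℝ ∞ (vecInChart X c) (extChartAt (𝓡 n) c).target)
    (h : p + q = n) {α Λ : FormField n M p} (hα : IsSmoothForm α)
    (hΛs : IsSmoothForm Λ) (hΛ : IsLieDerivative X α Λ) :
    ∫ x, wedgeBracketDensity g X h α x ∂(riemVolume g) = -2 * l2Inner g Λ α := by
  cases n with
  | zero =>
    have h1 : ∀ x, formInner g Λ α x = 0 := fun x => by
      rw [formInner, hΛ x, coordLie_of_subsingleton]
      simp [coordInner]
    simp only [wedgeBracketDensity_of_subsingleton, l2Inner, h1, integral_zero, mul_zero]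
  | succ m =>
    have hu : IsSmoothFun (n := m + 1) (formInner g α α) := fun c => contDiffOn_formInner g hα hα c
    simp only [wedgeBracketDensity_eq g hX h hα hΛ]
    rw [integral_sub (integrable_of_continuous g (continuous_divergence hX hu))
      ((integrable_of_continuous g (continuous_formInner g hΛs hα)).const_mul 2),
      integral_divergence_eq_zero hX hu, integral_const_mul, l2Inner]
    ring

end Bracket

/-! ### The inner product of form fields -/

section Hilbert

variable {n p : ℕ} {M : Type*} [TopologicalSpace M] [ChartedSpace (Coord n) M]
  [IsManifold (𝓡 n) ∞ M] [MeasurableSpace M]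

theorem l2Inner_comm (g : Metric n M) (α β : FormField n M p) : l2Inner g α β = l2Inner g β α := by
  simp only [l2Inner, formInner_comm g α β]

theorem l2Inner_self_nonneg (g : Metric n M) (α : FormField n M p) : 0 ≤ l2Inner g α α :=
  integral_nonneg fun x => formInner_self_nonneg g α x

theorem l2Inner_neg_left (g : Metric n M) (α β : FormField n M p) :
    l2Inner g (fun x => -α x) β = -l2Inner g α β := by
  simp only [l2Inner, formInner_neg_left, integral_neg]

theorem l2Inner_zero_left (g : Metric n M) (β : FormField n M p) :
    l2Inner g (fun _ => 0) β = 0 := by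
  have := l2Inner_neg_left g (fun _ => 0) β
  simp only [neg_zero] at this
  linarith

variable [BorelSpace M] [CompactSpace M]

theorem l2Inner_add_left (g : Metric n M) {α β γ : FormField n M p} (hα : IsSmoothForm α)
    (hβ : IsSmoothForm β) (hγ : IsSmoothForm γ) :
    l2Inner g (fun x => α x + β x) γ = l2Inner g α γ + l2Inner g β γ := by
  simp only [l2Inner, formInner_add_left]
  exact integral_add (integrable_of_continuous g (continuous_formInner g hα hγ))
    (integrable_of_continuous g (continuous_formInner g hβ hγ))

theorem eq_zero_of_l2Inner_self (g : Metric n M) {α : FormField n M p} (hα : IsSmoothForm α)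
    (h : l2Inner g α α = 0) (x : M) : α x = 0 := by
  have hc := continuous_formInner g hα hα
  have h1 := (integral_eq_zero_iff_of_nonneg (fun x => formInner_self_nonneg g α x)
    (integrable_of_continuous g hc)).1 h
  have h2 := (hc.ae_eq_iff_eq (riemVolume g) continuous_zero).1 h1
  exact formInner_self_eq_zero g (congrFun h2 x)

variable {g : Metric n M} {θ : FormField n M 1}

/-- Pairing the harmonic equation with `α` gives a sum of two squared norms equal to zero. In degree
zero only $\|d_\theta\alpha\|^2$ is present. -/
theorem IsThetaHarmonic.dTheta_eq_zero (hθ : IsSmoothForm θ) {α : FormField n M p}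
    (hα : IsSmoothForm α) (h : IsThetaHarmonic g θ α) (x : M) : dTheta θ α x = 0 := by
  refine eq_zero_of_l2Inner_self g (hθ.dTheta hα) ?_ x
  cases p with
  | zero =>
    rw [h.2 α hα, l2Inner_comm]
    exact l2Inner_zero_left g α
  | succ p =>
    obtain ⟨β, γ, hβ, hγ, hsum⟩ := h
    -- Here $\beta=d_\theta^*\alpha$ and $\gamma=d_\theta^*d_\theta\alpha$. Testing with `β` and
    -- then with `α` gives $\langle d_\theta\beta,\alpha\rangle=\|\beta\|^2$ and
    -- $\|d_\theta\alpha\|^2=\langle\alpha,\gamma\rangle$.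
    have h1 := hβ.2 β hβ.1
    have h2 := hγ.2 α hα
    have h3 := l2Inner_add_left g (hθ.dTheta hβ.1) hγ.1 hα
    rw [funext hsum, l2Inner_zero_left, l2Inner_comm g γ] at h3
    linarith [l2Inner_self_nonneg g β, l2Inner_self_nonneg g (dTheta θ α)]

/-- A harmonic form is orthogonal to the image of `d_θ`. -/
theorem IsThetaHarmonic.l2Inner_dTheta (hθ : IsSmoothForm θ) {α : FormField n M (p + 1)}
    (hα : IsSmoothForm α) (h : IsThetaHarmonic g θ α) {η : FormField n M p}
    (hη : IsSmoothForm η) : l2Inner g (dTheta θ η) α = 0 := by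
  have h0 := funext (h.dTheta_eq_zero hθ hα)
  obtain ⟨β, γ, hβ, hγ, hsum⟩ := h
  have h1 := hβ.2 β hβ.1
  have h2 := hγ.2 α hα
  have h3 := l2Inner_add_left g (hθ.dTheta hβ.1) hγ.1 hα
  rw [funext hsum, l2Inner_zero_left, l2Inner_comm g γ] at h3
  -- The same sum of squares also forces $d_\theta^*\alpha=0$.
  have h4 : β = fun _ => 0 := funext (eq_zero_of_l2Inner_self g hβ.1
    (by linarith [l2Inner_self_nonneg g β, l2Inner_self_nonneg g (dTheta θ α)]))
  rw [hβ.2 η hη, h4, l2Inner_comm, l2Inner_zero_left]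

variable {X : VecField n M} (hX : ∀ x v, g.inner x (X x) v = θ x (fun _ => v))

include hX

omit [BorelSpace M] [CompactSpace M] in
theorem l2Inner_wedge (η : FormField n M p) (α : FormField n M (p + 1)) :
    l2Inner g (fun x => wedge (Nat.add_comm 1 p) (θ x) (η x)) α =
      l2Inner g η (interiorField X α) := by
  simp only [l2Inner, formInner_wedge hX]

/-- The weak form of $d^*\alpha=-i_X\alpha$: split $d_\theta\eta$ and move $\theta\wedge$ to the
other side. It also exhibits $d^*\alpha$, whose existence is not presupposed. -/
theorem IsThetaHarmonic.l2Inner_extDer (hθ : IsSmoothForm θ) {α : FormField n M (p + 1)}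
    (hα : IsSmoothForm α) (h : IsThetaHarmonic g θ α) {η : FormField n M p}
    (hη : IsSmoothForm η) : l2Inner g (extDer η) α = -l2Inner g η (interiorField X α) := by
  have h1 := h.l2Inner_dTheta hθ hα hη
  unfold dTheta at h1
  rw [l2Inner_add_left g hη.extDer (hθ.wedge _ hη) hα, l2Inner_wedge hX] at h1
  linarith

theorem IsThetaHarmonic.isCodifferential (hθ : IsSmoothForm θ) {α : FormField n M p}
    (hα : IsSmoothForm α) (h : IsThetaHarmonic g θ α) :
    IsCodifferential g α fun x => -interiorField X α x := by
  cases p with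
  | zero => exact funext fun x => neg_zero (G := (TangentSpace (𝓡 n) x) [⋀^Fin (0 - 1)]→L[ℝ] ℝ)
  | succ p =>
    refine ⟨(isSmoothForm_interiorField hX hθ hα).neg, fun η hη => ?_⟩
    rw [h.l2Inner_extDer hX hθ hα hη, l2Inner_comm g η, l2Inner_comm g η, l2Inner_neg_left]

variable [T2Space M]

/-- The commutator integral is $-2\langle L_X\alpha,\alpha\rangle$, and Cartan's formula splits the
pairing into $-\|\theta\wedge\alpha\|^2$ and $-\|i_X\alpha\|^2$, which add up to
$-\int|X|^2|\alpha|^2$. -/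
theorem IsThetaHarmonic.integral_eq {q : ℕ} (hpq : p + q = n) (hθ : IsSmoothForm θ)
    {α : FormField n M p} (hα : IsSmoothForm α) (h : IsThetaHarmonic g θ α) :
    ∫ x, g.inner x (X x) (X x) * formInner g α α x ∂(riemVolume g) =
      (1 / 2) * ∫ x, wedgeBracketDensity g X hpq α x ∂(riemVolume g) := by
  have hXs := contDiffOn_vecInChart_dual hX hθ
  have hd : (extDer α) = fun x => -wedge (Nat.add_comm 1 p) (θ x) (α x) := funext fun x =>
    eq_neg_of_add_eq_zero_left (h.dTheta_eq_zero hθ hα x)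
  have hw : IsSmoothForm fun x => wedge (Nat.add_comm 1 p) (θ x) (α x) := hθ.wedge _ hα
  have hid : IsSmoothForm (interiorField X (extDer α)) :=
    isSmoothForm_interiorField hX hθ hα.extDer
  -- Adjointness turns $\langle i_Xd\alpha,\alpha\rangle$ into $\langle
  -- d\alpha,\theta\wedge\alpha\rangle$, and $d\alpha=-\theta\wedge\alpha$.
  have hwedge : l2Inner g (p := p) (interiorField X (extDer α)) α =
      -l2Inner g (fun x => wedge (Nat.add_comm 1 p) (θ x) (α x))
        fun x => wedge (Nat.add_comm 1 p) (θ x) (α x) := by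
    rw [l2Inner_comm]
    refine (l2Inner_wedge hX α (extDer α)).symm.trans ?_
    rw [hd, l2Inner_comm, l2Inner_neg_left]
  cases p with
  | zero =>
    rw [integral_wedgeBracketDensity g hXs hpq hα hid (isLieDerivative_zero X hα)]
    rw [hwedge]
    simp only [← formInner_wedge_self_zero hX]
    rw [l2Inner]
    ring
  | succ p =>
    have hi : IsSmoothForm (p := p) (interiorField X α) := isSmoothForm_interiorField hX hθ hα
    rw [integral_wedgeBracketDensity g hXs hpq hα (IsSmoothForm.add (p := p + 1) hid hi.extDer)
      (isLieDerivative_succ hXs hα rfl hi rfl)]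
    have h1 := l2Inner_add_left (p := p + 1) g hid hi.extDer hα
    -- The test form $\eta=i_X\alpha$ gives $\langle d\,i_X\alpha,\alpha\rangle=-\|i_X\alpha\|^2$.
    have h2 := h.l2Inner_extDer hX hθ hα hi
    simp only [← formInner_wedge_self_succ hX]
    rw [integral_add (integrable_of_continuous g (continuous_formInner g hw hw))
      (integrable_of_continuous g (continuous_formInner g hi hi))]
    refine Eq.trans ?_ (congrArg (fun t => (1 / 2 : ℝ) * (-2 * t)) h1).symm
    rw [hwedge]
    refine Eq.trans ?_ (congrArg (fun t => (1 / 2 : ℝ) * (-2 * (_ + t))) h2).symm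
    simp only [l2Inner]
    ring

end Hilbert

end MorseNovikov

end

theorem theorem4p1 {n p q : ℕ} (hpq : p + q = n)
    {M : Type*} [TopologicalSpace M] [T2Space M] [CompactSpace M]
    [ChartedSpace (Coord n) M] [IsManifold (𝓡 n) ∞ M]
    [MeasurableSpace M] [BorelSpace M]
    (g : MorseNovikov.Metric n M)
    (θ : FormField n M 1) (hθ : IsSmoothForm θ) (hclosed : ∀ x, extDer θ x = 0)
    (X : VecField n M) (hX : ∀ x v, g.inner x (X x) v = θ x (fun _ => v))
    (α : FormField n M p) (hα : IsSmoothForm α) (hharm : IsThetaHarmonic g θ α) :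
    (∀ x, extDer α x + wedge (Nat.add_comm 1 p) (θ x) (α x) = 0) ∧
    (∃ δ : FormField n M (p - 1), IsCodifferential g α δ ∧ ∀ x, δ x + interiorField X α x = 0) ∧
    ∫ x, g.inner x (X x) (X x) * formInner g α α x ∂(riemVolume g) =
      (1 / 2) * ∫ x, wedgeBracketDensity g X hpq α x ∂(riemVolume g) := by
  refine ⟨fun x => hharm.dTheta_eq_zero hθ hα x, ⟨_, hharm.isCodifferential hX hθ hα, fun x => ?_⟩,
    hharm.integral_eq hX hpq hθ hα⟩
  exact neg_add_cancel (G := (TangentSpace (𝓡 n) x) [⋀^Fin (p - 1)]→L[ℝ] ℝ) _
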